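/- Model of computation. Let $m,d\ge 1$, $A\in\mathbb R^{m\times d}$, $b\in\mathbb R^m$. An iterative method works with registers holding vectors of $\mathbb R^d$ and of $\mathbb R^m$, and a control state that is kept between iterations. Initially one $\mathbb R^d$-register holds the starting point $x_0$, one $\mathbb R^m$-register holds $b$, and all others hold $0$. The matrix $A$, the vector $b$ and the coordinates of vectors are accessible only through the following unit-cost instructions: (i) the gradient oracle $x\mapsto\nabla f_\mu(x)$, for any $\mu$ the method chooses, where $f_\mu(x)=\mu\log\sum_{i=1}^m\left(e^{(Ax-b)_i/\mu}+e^{-(Ax-b)_i/\mu}\right)$ is the softmax approximation of $\|Ax-b\|_\infty$; (ii) the linear system solver which, for a vector $w\in\mathbb R^d$ and a diagonal matrix $D\in\mathbb R^{m\times m}$ given by its diagonal, returns the solution $\phi$ of $A^\top DA\phi=w$ (and $0$ if $A^\top DA$ is singular); (iii) elementary vector operations: $x\mapsto Ax$, $u\mapsto A^\top u$, linear combinations, the all-ones vector of $\mathbb R^m$, and coordinatewise products and exponentials in $\mathbb R^m$; (iv) the inner product of two vectors, and the norm $\|u\|_\infty$ of a vector $u\in\mathbb R^m$, each returned to the control as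 a real number. The control may use the real numbers so obtained freely. The cost of an iteration is the number of instructions (i)-(iv) executed in it; $x_k$ denotes the content of the first $\mathbb R^d$-register after $k$ iterations. Theorem. There are universal constants $C,K>0$ and $p\in\mathbb N$ and a method, which receives only $m$, $d$, $\varepsilon$, the number $N$ of iterations and the initial registers, such that the following holds. Let $m\ge 2$, $A\in\mathbb R^{m\times d}$ with $A^\top A\succ 0$, $b\in\mathbb R^m$, $f(x)=\|Ax-b\|_\infty$, let $x^*$ be any minimizer of $f$ over $\mathbb R^d$, let $x_0\in\mathbb R^d$ and $\varepsilon>0$, and let $R\ge\|x_0-x^*\|_{A^\top A}$ (for instance $R=\|x_0-x^*\|_{A^\top A}$), where $\|v\|_{B}=\sqrt{v^\top Bv}$. Then, started at $x_0$ and run for $$N=\left\lfloor C\,\frac{\log^{3/5}(m)\,R^{4/5}}{\varepsilon^{4/5}}\right\rfloor$$ iterations, the method outputs a point $x_N$ with $f(x_N)-f(x^*)\le\varepsilon$, and each of these iterations has cost at most $K\log^{p}(2+Z/\varepsilon)$ with $Z=mR$. In particular each iteration makes at most that many calls to the gradient oracle and solves at most that many linear systems $A^\top DA\phi=w$. -/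

import Mathlib

open scoped Matrix

namespace LinfReg

noncomputable section

/-- The objective `f(x) = ‖A x - b‖_∞`. The norm on `Fin m → ℝ` is the maximum of the absolute
values of the coordinates. -/
def objective {m d : ℕ} (A : Matrix (Fin m) (Fin d) ℝ) (b : Fin m → ℝ) (x : Fin d → ℝ) : ℝ :=
  ‖A *ᵥ x - b‖

/-- The norm `‖v‖_B = √(vᵀ B v)` induced by a positive definite matrix `B`. -/
def matNorm {d : ℕ} (B : Matrix (Fin d) (Fin d) ℝ) (v : Fin d → ℝ) : ℝ :=
  Real.sqrt (v ⬝ᵥ (B *ᵥ v))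

/-- The softmax function `smax_μ(y) = μ log (∑ i, exp (y i / μ))`. -/
def smax {ι : Type} [Fintype ι] (μ : ℝ) (y : ι → ℝ) : ℝ :=
  μ * Real.log (∑ i, Real.exp (y i / μ))

/-- The smooth approximation of `‖A x - b‖_∞`: the softmax of the `2 m` numbers
`(A x - b) i` and `-(A x - b) i`. -/
def smoothObjective {m d : ℕ} (A : Matrix (Fin m) (Fin d) ℝ) (b : Fin m → ℝ) (μ : ℝ)
    (x : Fin d → ℝ) : ℝ :=
  smax μ (Sum.elim (A *ᵥ x - b) (-(A *ᵥ x - b)))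

/-- The gradient (vector of partial derivatives) of a function on `ℝ^d`. -/
def grad {d : ℕ} (f : (Fin d → ℝ) → ℝ) (x : Fin d → ℝ) : Fin d → ℝ :=
  fun i => fderiv ℝ f x (Pi.single i 1)

/-! ### The model of computation

A program manipulates vectors of `ℝ^d` and of `ℝ^m`, held in registers that are addressed by natural
numbers. It never sees `A`, `b` or a coordinate of a vector: it can only execute the instructions
below. The result of a `ScalarQuery` is a real number, which it may use freely. Every executed
instruction, be it an oracle call or an elementary vector operation, is counted. -/

/-- The contents of the registers: `x i` are vectors of `ℝ^d`, `u i` are vectors of `ℝ^m`. -/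
structure Regs (m d : ℕ) where
  x : ℕ → Fin d → ℝ
  u : ℕ → Fin m → ℝ

/-- The instructions that write a vector into the register `out`. -/
inductive VecOp : Type
  /-- gradient oracle: `x out := ∇ f_μ (x i)` for the smooth approximation `f_μ` -/
  | gradient (μ : ℝ) (i out : ℕ)
  /-- linear system solver: `x out := φ` where `Aᵀ D A φ = x j`, with `D` the diagonal matrix with
  diagonal `u i` -/
  | solve (i j out : ℕ)
  /-- `u out := A (x i)` -/
  | mulA (i out : ℕ)
  /-- `x out := Aᵀ (u i)` -/
  | mulAT (i out : ℕ)
  /-- `x out := a (x i) + c (x j)` -/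
  | linComb (a : ℝ) (i : ℕ) (c : ℝ) (j out : ℕ)
  /-- `u out := a (u i) + c (u j)` -/
  | linCombU (a : ℝ) (i : ℕ) (c : ℝ) (j out : ℕ)
  /-- `u out := (1, …, 1)` -/
  | onesU (out : ℕ)
  /-- `u out := u i ∘ u j`, the coordinatewise product -/
  | hadamardU (i j out : ℕ)
  /-- `u out := exp (u i)`, coordinatewise -/
  | expU (i out : ℕ)

/-- The instructions whose result is a real number. -/
inductive ScalarQuery : Type
  /-- the inner product of `x i` and `x j` -/
  | inner (i j : ℕ)
  /-- the inner product of `u i` and `u j` -/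
  | innerU (i j : ℕ)
  /-- the maximum norm of `u i` -/
  | maxNormU (i : ℕ)

/-- Write the vector `v` of `ℝ^d` into register `k`. -/
def Regs.setX {m d : ℕ} (s : Regs m d) (k : ℕ) (v : Fin d → ℝ) : Regs m d :=
  { s with x := Function.update s.x k v }

/-- Write the vector `v` of `ℝ^m` into register `k`. -/
def Regs.setU {m d : ℕ} (s : Regs m d) (k : ℕ) (v : Fin m → ℝ) : Regs m d :=
  { s with u := Function.update s.u k v }

/-- The effect of an instruction on the registers. The solver returns the unique solution of the
system if `Aᵀ D A` is invertible, and `0` otherwise. -/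
def VecOp.apply {m d : ℕ} (A : Matrix (Fin m) (Fin d) ℝ) (b : Fin m → ℝ) (s : Regs m d) :
    VecOp → Regs m d
  | .gradient μ i out => s.setX out (grad (smoothObjective A b μ) (s.x i))
  | .solve i j out => s.setX out ((Aᵀ * Matrix.diagonal (s.u i) * A)⁻¹ *ᵥ s.x j)
  | .mulA i out => s.setU out (A *ᵥ s.x i)
  | .mulAT i out => s.setX out (Aᵀ *ᵥ s.u i)
  | .linComb a i c j out => s.setX out (a • s.x i + c • s.x j)
  | .linCombU a i c j out => s.setU out (a • s.u i + c • s.u j)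
  | .onesU out => s.setU out (fun _ => 1)
  | .hadamardU i j out => s.setU out (s.u i * s.u j)
  | .expU i out => s.setU out (fun l => Real.exp (s.u i l))

/-- The value returned by a scalar query. -/
def ScalarQuery.value {m d : ℕ} (s : Regs m d) : ScalarQuery → ℝ
  | .inner i j => s.x i ⬝ᵥ s.x j
  | .innerU i j => s.u i ⬝ᵥ s.u j
  | .maxNormU i => ‖s.u i‖

/-- A terminating program with a result of type `α`: after a scalar query the continuation may
depend on the answer. -/
inductive Prog (α : Type) : Type
  | done (a : α) : Prog α
  | op (c : VecOp) (next : Prog α) : Prog α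
  | query (q : ScalarQuery) (next : ℝ → Prog α) : Prog α

/-- Run a program: its result and the final contents of the registers. -/
def Prog.run {α : Type} {m d : ℕ} (A : Matrix (Fin m) (Fin d) ℝ) (b : Fin m → ℝ) :
    Prog α → Regs m d → α × Regs m d
  | .done a, s => (a, s)
  | .op c next, s => next.run A b (c.apply A b s)
  | .query q next, s => (next (q.value s)).run A b s

/-- The number of instructions that a program executes. -/
def Prog.cost {α : Type} {m d : ℕ} (A : Matrix (Fin m) (Fin d) ℝ) (b : Fin m → ℝ) :
    Prog α → Regs m d → ℕ
  | .done _, _ => 0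
  | .op c next, s => next.cost A b (c.apply A b s) + 1
  | .query q next, s => (next (q.value s)).cost A b s + 1

/-- An iterative method: a control state, which is kept from one iteration to the next beside
the registers, and the program that an iteration executes in a given control state. -/
structure Method where
  State : Type
  init : State
  step : State → Prog State

/-- Initially the register `x 0` holds the starting point, `u 0` holds `b`, all others hold `0`. -/
def initRegs {m d : ℕ} (b : Fin m → ℝ) (x₀ : Fin d → ℝ) : Regs m d where
  x := fun i => if i = 0 then x₀ else 0
  u := fun i => if i = 0 then b else 0

/-- Control state and registers after `k` iterations. -/
def Method.exec (M : Method) {m d : ℕ} (A : Matrix (Fin m) (Fin d) ℝ) (b : Fin m → ℝ)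
    (x₀ : Fin d → ℝ) : ℕ → M.State × Regs m d
  | 0 => (M.init, initRegs b x₀)
  | k + 1 => (M.step (M.exec A b x₀ k).1).run A b (M.exec A b x₀ k).2

/-- The point `x_k` after `k` iterations: the contents of the register `x 0`. -/
def Method.iterate (M : Method) {m d : ℕ} (A : Matrix (Fin m) (Fin d) ℝ) (b : Fin m → ℝ)
    (x₀ : Fin d → ℝ) (k : ℕ) : Fin d → ℝ :=
  (M.exec A b x₀ k).2.x 0

/-- The number of instructions executed in the iteration that leads from `x_k` to `x_{k+1}`. -/
def Method.iterCost (M : Method) {m d : ℕ} (A : Matrix (Fin m) (Fin d) ℝ) (b : Fin m → ℝ)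
    (x₀ : Fin d → ℝ) (k : ℕ) : ℕ :=
  (M.step (M.exec A b x₀ k).1).cost A b (M.exec A b x₀ k).2

end

end LinfReg

/-!
The method minimises the softmax approximation `f_μ` with `μ = ε / (2 log (2 m))`, which exceeds
`f = ‖A x - b‖_∞` by at most `ε / 2`, with the accelerated proximal point method of Monteiro and
Svaiter. All norms below are `‖u‖ = ‖A u‖₂`, the norm of `AᵀA`, which dominates `‖A u‖_∞`.

*Acceleration.* From an extrapolated point `y`, which depends on a step size `lam'`, an approximate
minimiser `t` of `lam f_μ + ‖· - y‖² / 2` with `lam ≤ lam'` yields a step, damped by `lam / lam'`,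
that decreases the potential `a (f_μ x - f_μ x*) + ‖v - x*‖² / 2` by the order of
`(a / lam') ‖t - y‖²` (`accel_step`), while an undamped step increases the mass `a` by at least
`√(lam' a)`. On a geometric grid of `J + 1` step sizes there are two neighbours such that the
smaller one allows an undamped step, and the larger one a damped step with `‖t - y‖ ≥ r`, `r` of the
order of `μ`; otherwise the largest step size is reached and the mass becomes large at once. The
potential is convex in `(a, a x, v)`, so it is not necessary to find these neighbours: the method
takes the mean of the steps for all pairs of step sizes and loses only a factor `(J + 1)²`
(`accel_average`, `accel_progress`). Balancing the growth of the mass against the decrease of the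
potential shows that of the order of `(R / r)^{2/3}` steps suffice, up to powers of `J`
(`smoothObjective_track_sub_le`).

*Proximal points.* The softmax is quasi-self-concordant: on balls of radius of the order of `μ` its
quadratic model has a small relative error (`abs_slope_sub_le`), so that Newton's method for the
proximal objective converges linearly once the Newton step is that short (`newton_decrement_le`). An
approximate proximal point for `lam` with displacement at most `r` is a good enough start for the step
size `2 lam` (`isApproxProx_iterate`). Hence `O(J)` Newton steps for each step size of the grid follow
the path of proximal points until it leaves the ball of radius `r` (`exists_isApproxProx`). The
Hessian of the proximal objective is `Aᵀ D A` minus a rank-one matrix, so a Newton step takes two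
linear systems.

*Budget.* The exponent `2/3` is smaller than `4/5`, and `J` is of the order of `log (2 + m R / ε)`,
so the steps fit into `N` iterations of polylogarithmic cost. The method knows `m` and `N`, hence
`R / ε` up to a constant factor (`ratioBound`), which is all it needs to choose `J`. If `N = 0`, then
`R ≤ ε`, and `x₀` is good enough because `f` is 1-Lipschitz.
-/

namespace LinfReg

noncomputable section

/-! ### Gibbs weights -/

section Gibbs

variable {ι : Type} [Fintype ι]

/-- The mean of `f` under the weights `w`. -/
def mean (w f : ι → ℝ) : ℝ := ∑ k, w k * f k

/-- The covariance of `f` and `g` under the weights `w`. -/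
def cov (w f g : ι → ℝ) : ℝ := ∑ k, w k * ((f k - mean w f) * (g k - mean w g))

/-- The exponential tilt of the weights `w` by `a`. -/
def tilt (w a : ι → ℝ) : ι → ℝ := fun k => w k * Real.exp (a k) / ∑ j, w j * Real.exp (a j)

/-- The Gibbs weights `exp (z k / μ) / ∑ j, exp (z j / μ)`, the gradient of `smax μ` at `z`. -/
def gibbs (μ : ℝ) (z : ι → ℝ) : ι → ℝ :=
  fun k => Real.exp (z k / μ) / ∑ j, Real.exp (z j / μ)

lemma mean_add (w f g : ι → ℝ) : mean w (f + g) = mean w f + mean w g := by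
  simp [mean, mul_add, Finset.sum_add_distrib]

lemma mean_smul (w f : ι → ℝ) (c : ℝ) : mean w (c • f) = c * mean w f := by
  simp [mean, Finset.mul_sum]; congr 1; ext k; ring

lemma abs_mean_le {w f : ι → ℝ} {τ : ℝ} (hw : ∀ k, 0 ≤ w k) (h1 : ∑ k, w k = 1)
    (hf : ∀ k, |f k| ≤ τ) : |mean w f| ≤ τ := by
  calc |mean w f| ≤ ∑ k, |w k * f k| := Finset.abs_sum_le_sum_abs _ _
    _ ≤ ∑ k, w k * τ := by
        gcongr with k
        rw [abs_mul, abs_of_nonneg (hw k)]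
        exact mul_le_mul_of_nonneg_left (hf k) (hw k)
    _ = τ := by rw [← Finset.sum_mul, h1, one_mul]

lemma cov_eq {w : ι → ℝ} (h1 : ∑ k, w k = 1) (f g : ι → ℝ) :
    cov w f g = mean w (f * g) - mean w f * mean w g := by
  have : ∀ k, w k * ((f k - mean w f) * (g k - mean w g)) =
      w k * (f k * g k) - mean w g * (w k * f k) - mean w f * (w k * g k)
        + mean w f * mean w g * w k := fun k => by ring
  simp only [cov, this, Finset.sum_add_distrib, Finset.sum_sub_distrib, ← Finset.mul_sum, h1]
  simp only [mean, Pi.mul_apply]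
  ring

lemma cov_add_left {w : ι → ℝ} (h1 : ∑ k, w k = 1) (f f' g : ι → ℝ) :
    cov w (f + f') g = cov w f g + cov w f' g := by
  simp only [cov_eq h1, mean_add, add_mul]; ring

lemma cov_smul_left {w : ι → ℝ} (h1 : ∑ k, w k = 1) (c : ℝ) (f g : ι → ℝ) :
    cov w (c • f) g = c * cov w f g := by
  simp only [cov_eq h1, mean_smul, smul_mul_assoc]; ring

lemma cov_comm (w f g : ι → ℝ) : cov w f g = cov w g f := by
  simp only [cov]; congr 1; ext k; ring

lemma cov_self_nonneg {w : ι → ℝ} (hw : ∀ k, 0 ≤ w k) (f : ι → ℝ) : 0 ≤ cov w f f :=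
  Finset.sum_nonneg fun k _ => mul_nonneg (hw k) (mul_self_nonneg _)

/-- The mean minimises the mean square deviation. -/
lemma cov_self_le {w : ι → ℝ} (h1 : ∑ k, w k = 1) (f : ι → ℝ) (c : ℝ) :
    cov w f f ≤ ∑ k, w k * (f k - c) ^ 2 := by
  have : ∀ k, w k * (f k - c) ^ 2 = w k * (f k * f k) - 2 * c * (w k * f k) + c ^ 2 * w k :=
    fun k => by ring
  rw [cov_eq h1]
  simp only [this, Finset.sum_add_distrib, Finset.sum_sub_distrib, ← Finset.mul_sum, h1]
  simp only [mean, Pi.mul_apply]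
  nlinarith [sq_nonneg (∑ k, w k * f k - c)]

lemma sum_abs_mul_le {w : ι → ℝ} (hw : ∀ k, 0 ≤ w k) (f g : ι → ℝ) :
    ∑ k, w k * (|f k - mean w f| * |g k - mean w g|) ≤ √(cov w f f) * √(cov w g g) := by
  have h := Real.sum_mul_le_sqrt_mul_sqrt Finset.univ
    (fun k => √(w k) * |f k - mean w f|) (fun k => √(w k) * |g k - mean w g|)
  have e1 : ∀ k, √(w k) * |f k - mean w f| * (√(w k) * |g k - mean w g|) =
      w k * (|f k - mean w f| * |g k - mean w g|) := fun k => by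
    rw [mul_mul_mul_comm, Real.mul_self_sqrt (hw k)]
  have e2 : ∀ (h : ι → ℝ) k, (√(w k) * |h k - mean w h|) ^ 2 =
      w k * ((h k - mean w h) * (h k - mean w h)) := fun h k => by
    rw [mul_pow, Real.sq_sqrt (hw k), sq_abs, sq]
  simp only [e1, e2] at h
  exact h

lemma abs_cov_le {w : ι → ℝ} (hw : ∀ k, 0 ≤ w k) (f g : ι → ℝ) :
    |cov w f g| ≤ √(cov w f f) * √(cov w g g) := by
  refine le_trans ?_ (sum_abs_mul_le hw f g)
  refine (Finset.abs_sum_le_sum_abs _ _).trans (le_of_eq ?_)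
  simp [abs_mul, abs_of_nonneg (hw _)]

lemma sum_mul_exp_pos {w : ι → ℝ} (hw : ∀ k, 0 ≤ w k) (h1 : ∑ k, w k = 1) (a : ι → ℝ) :
    0 < ∑ j, w j * Real.exp (a j) := by
  obtain ⟨k, -, hk⟩ : ∃ k ∈ Finset.univ, 0 < w k := by
    by_contra! h
    have := Finset.sum_nonpos h
    linarith
  exact Finset.sum_pos' (fun j _ => mul_nonneg (hw j) (Real.exp_pos _).le)
    ⟨k, Finset.mem_univ _, mul_pos hk (Real.exp_pos _)⟩

lemma sum_tilt {w : ι → ℝ} (hw : ∀ k, 0 ≤ w k) (h1 : ∑ k, w k = 1) (a : ι → ℝ) :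
    ∑ k, tilt w a k = 1 := by
  simp only [tilt, ← Finset.sum_div]
  exact div_self (sum_mul_exp_pos hw h1 a).ne'

lemma tilt_sub_const (w a : ι → ℝ) (c : ℝ) : tilt w (fun k => a k - c) = tilt w a := by
  ext k
  simp only [tilt, Real.exp_sub, ← mul_div_assoc, ← Finset.sum_div]
  rw [div_div_div_cancel_right₀ (Real.exp_pos c).ne']

/-- A bounded tilt changes variances by a bounded factor. -/
lemma cov_self_le_tilt {w a : ι → ℝ} {τ : ℝ} (hw : ∀ k, 0 ≤ w k) (h1 : ∑ k, w k = 1)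
    (ha : ∀ k, |a k| ≤ τ) (f : ι → ℝ) :
    cov w f f ≤ Real.exp (2 * τ) * cov (tilt w a) f f := by
  refine (cov_self_le h1 f (mean (tilt w a) f)).trans ?_
  rw [cov, Finset.mul_sum]
  refine Finset.sum_le_sum fun k _ => ?_
  rw [← sq, ← mul_assoc]
  refine mul_le_mul_of_nonneg_right ?_ (sq_nonneg _)
  have hZ := sum_mul_exp_pos hw h1 a
  rw [tilt, ← mul_div_assoc, le_div_iff₀ hZ]
  have hZle : ∑ j, w j * Real.exp (a j) ≤ Real.exp τ := by
    calc ∑ j, w j * Real.exp (a j) ≤ ∑ j, w j * Real.exp τ := by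
          gcongr with j
          · exact hw j
          · exact (abs_le.1 (ha j)).2
      _ = Real.exp τ := by rw [← Finset.sum_mul, h1, one_mul]
  calc w k * ∑ j, w j * Real.exp (a j) ≤ w k * Real.exp τ :=
        mul_le_mul_of_nonneg_left hZle (hw k)
    _ ≤ w k * (Real.exp (2 * τ) * Real.exp (a k)) := by
        refine mul_le_mul_of_nonneg_left ?_ (hw k)
        rw [← Real.exp_add]
        exact Real.exp_le_exp.2 (by linarith [(abs_le.1 (ha k)).1])
    _ = _ := by ring

/-- Under a small tilt `a` the mean of `f` changes by `cov w a f`, up to second order. This is the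
quasi-self-concordance of the softmax: the error is relative to the standard deviations. -/
lemma abs_mean_tilt_sub_le {w a : ι → ℝ} {τ : ℝ} (hw : ∀ k, 0 ≤ w k) (h1 : ∑ k, w k = 1)
    (ha : ∀ k, |a k| ≤ τ) (hτ : τ ≤ 1 / 2) (f : ι → ℝ) :
    |mean (tilt w a) f - mean w f - cov w a f| ≤ 4 * τ * (√(cov w a a) * √(cov w f f)) := by
  set B := √(cov w a a) * √(cov w f f) with hB
  have hB0 : 0 ≤ B := by positivity
  -- Centre both functions; the tilt does not see the constant.
  set c : ι → ℝ := fun k => a k - mean w a with hc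
  set g : ι → ℝ := fun k => f k - mean w f with hg
  have hcb : ∀ k, |c k| ≤ 2 * τ := fun k => by
    have := abs_mean_le hw h1 ha
    calc |c k| ≤ |a k| + |mean w a| := abs_sub _ _
      _ ≤ 2 * τ := by linarith [ha k]
  have hmc : ∑ k, w k * c k = 0 := by
    simp only [hc, mul_sub, Finset.sum_sub_distrib, ← Finset.sum_mul, h1]
    simp [mean]
  have hmg : ∑ k, w k * g k = 0 := by
    simp only [hg, mul_sub, Finset.sum_sub_distrib, ← Finset.sum_mul, h1]
    simp [mean]
  set Z := ∑ k, w k * Real.exp (c k) with hZ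
  have hZ1 : 1 ≤ Z := by
    calc (1 : ℝ) = ∑ k, w k * (c k + 1) := by
          simp [mul_add, Finset.sum_add_distrib, hmc, h1]
      _ ≤ Z := by
          refine Finset.sum_le_sum fun k _ => mul_le_mul_of_nonneg_left (Real.add_one_le_exp _) (hw k)
  have hrem : ∀ k, |Real.exp (c k) - 1 - c k| ≤ 2 * τ * |c k| := fun k => by
    have h2 : |c k| ≤ 1 := (hcb k).trans (by linarith)
    refine (Real.abs_exp_sub_one_sub_id_le h2).trans ?_
    rw [← sq_abs, sq]
    exact mul_le_mul_of_nonneg_right (hcb k) (abs_nonneg _)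
  have hZ2 : |Z - 1| ≤ 2 * τ := by
    have : Z - 1 = mean w (fun k => Real.exp (c k) - 1 - c k) := by
      simp [mean, mul_sub, Finset.sum_sub_distrib, hmc, h1, hZ]
    rw [this]
    refine abs_mean_le hw h1 fun k => (hrem k).trans ?_
    have h0 : 0 ≤ 2 * τ := (abs_nonneg _).trans (hcb k)
    have h2 : |c k| ≤ 1 := (hcb k).trans (by linarith)
    nlinarith
  set V := cov w a f with hV
  have hVc : V = ∑ k, w k * (c k * g k) := rfl
  have hVB : |V| ≤ B := abs_cov_le hw a f
  set M := ∑ k, w k * (Real.exp (c k) * g k) with hM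
  have hMV : |M - V| ≤ 2 * τ * B := by
    have : M - V = ∑ k, w k * ((Real.exp (c k) - 1 - c k) * g k) := by
      have e : ∀ k, w k * ((Real.exp (c k) - 1 - c k) * g k) =
        w k * (Real.exp (c k) * g k) - w k * g k - w k * (c k * g k) := fun k => by ring
      simp only [e, Finset.sum_sub_distrib, hmg, hM, hVc]; ring
    rw [this]
    calc _ ≤ ∑ k, |w k * ((Real.exp (c k) - 1 - c k) * g k)| := Finset.abs_sum_le_sum_abs _ _
      _ ≤ ∑ k, 2 * τ * (w k * (|c k| * |g k|)) := by
          refine Finset.sum_le_sum fun k _ => ?_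
          rw [abs_mul, abs_mul, abs_of_nonneg (hw k)]
          have := mul_le_mul_of_nonneg_left
            (mul_le_mul_of_nonneg_right (hrem k) (abs_nonneg (g k))) (hw k)
          linarith
      _ ≤ 2 * τ * B := by
          rw [← Finset.mul_sum]
          rcases isEmpty_or_nonempty ι with hι | ⟨⟨k⟩⟩
          · simp at h1
          · exact mul_le_mul_of_nonneg_left (sum_abs_mul_le hw a f)
              ((abs_nonneg _).trans (hcb k))
  have hmean : mean (tilt w a) f - mean w f = M / Z := by
    have hs : ∑ k, tilt w a k = 1 := sum_tilt hw h1 a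
    have e : mean (tilt w a) f - mean w f = ∑ k, tilt w a k * g k := by
      simp only [hg, mul_sub, Finset.sum_sub_distrib, ← Finset.sum_mul, hs, one_mul]
      rfl
    rw [e, ← tilt_sub_const w a (mean w a)]
    simp only [tilt, hM, Finset.sum_div]
    refine Finset.sum_congr rfl fun k _ => ?_
    simp only [hZ, hc]
    ring
  have hτ0 : 0 ≤ 2 * τ := (abs_nonneg _).trans hZ2
  have hZ0 : 0 < Z := by linarith
  rw [hmean, show M / Z - V = ((M - V) - V * (Z - 1)) / Z by field_simp; ring, abs_div,
    abs_of_pos hZ0, div_le_iff₀ hZ0]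
  calc |M - V - V * (Z - 1)| ≤ |M - V| + |V| * |Z - 1| := by
        rw [← abs_mul]; exact abs_sub _ _
    _ ≤ 2 * τ * B + B * (2 * τ) := by gcongr
    _ = 4 * τ * B * 1 := by ring
    _ ≤ 4 * τ * B * Z := by
        refine mul_le_mul_of_nonneg_left hZ1 ?_
        nlinarith

variable [Nonempty ι]

lemma sum_exp_pos (μ : ℝ) (z : ι → ℝ) : 0 < ∑ j, Real.exp (z j / μ) :=
  Finset.sum_pos (fun _ _ => Real.exp_pos _) Finset.univ_nonempty

lemma gibbs_nonneg (μ : ℝ) (z : ι → ℝ) (k : ι) : 0 ≤ gibbs μ z k :=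
  div_nonneg (Real.exp_pos _).le (sum_exp_pos μ z).le

lemma sum_gibbs (μ : ℝ) (z : ι → ℝ) : ∑ k, gibbs μ z k = 1 := by
  simp only [gibbs, ← Finset.sum_div]
  exact div_self (sum_exp_pos μ z).ne'

lemma gibbs_add (μ : ℝ) (z h : ι → ℝ) :
    gibbs μ (z + h) = tilt (gibbs μ z) (fun k => h k / μ) := by
  ext k
  have hS := sum_exp_pos μ z
  simp only [gibbs, tilt, Pi.add_apply, add_div, Real.exp_add, div_mul_eq_mul_div, ← Finset.sum_div]
  rw [div_div_div_cancel_right₀ hS.ne']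

/-- The softmax lies above its linearisation. -/
lemma smax_add_mean_le {μ : ℝ} (hμ : 0 < μ) (z z' : ι → ℝ) :
    smax μ z + mean (gibbs μ z) (z' - z) ≤ smax μ z' := by
  have hS := sum_exp_pos μ z
  have hS' := sum_exp_pos μ z'
  set c := mean (gibbs μ z) (z' - z) with hc
  -- `e^{-c/μ} S(z') / S(z)` is a mean of exponentials whose exponents have mean `0`.
  have key : Real.exp (c / μ) * ∑ j, Real.exp (z j / μ) ≤ ∑ j, Real.exp (z' j / μ) := by
    have h1 : ∀ k, gibbs μ z k * ((z' k - z k - c) / μ + 1) ≤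
        gibbs μ z k * Real.exp ((z' k - z k - c) / μ) := fun k =>
      mul_le_mul_of_nonneg_left (Real.add_one_le_exp _) (gibbs_nonneg μ z k)
    have h2 := Finset.sum_le_sum fun k (_ : k ∈ Finset.univ) => h1 k
    have h3 : ∑ k, gibbs μ z k * ((z' k - z k - c) / μ + 1) = 1 := by
      have e : ∀ k, gibbs μ z k * ((z' k - z k - c) / μ + 1) =
        (1 / μ) * (gibbs μ z k * (z' k - z k)) - c / μ * gibbs μ z k + gibbs μ z k :=
        fun k => by ring
      simp only [e, Finset.sum_add_distrib, Finset.sum_sub_distrib, ← Finset.mul_sum, sum_gibbs]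
      simp only [hc, mean, Pi.sub_apply]; ring
    have h4 : ∀ k, gibbs μ z k * Real.exp ((z' k - z k - c) / μ) =
        Real.exp (z' k / μ) / (Real.exp (c / μ) * ∑ j, Real.exp (z j / μ)) := fun k => by
      rw [gibbs, show (z' k - z k - c) / μ = z' k / μ - z k / μ - c / μ by ring, Real.exp_sub,
        Real.exp_sub]
      field_simp
    simp only [h4, ← Finset.sum_div] at h2
    rw [h3, one_le_div (by positivity)] at h2
    exact h2
  have := Real.log_le_log (by positivity) key
  rw [Real.log_mul (Real.exp_pos _).ne' hS.ne', Real.log_exp] at this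
  have h5 := mul_le_mul_of_nonneg_left this hμ.le
  rw [mul_add, mul_div_cancel₀ _ hμ.ne'] at h5
  simp only [smax]
  linarith

end Gibbs

/-! ### The softmax objective in the geometry of `AᵀA` -/

section Model

variable {m d : ℕ}

/-- The `2 m` numbers `y i` and `-y i`. -/
def pm (y : Fin m → ℝ) : Fin m ⊕ Fin m → ℝ := Sum.elim y (-y)

lemma pm_add (y z : Fin m → ℝ) : pm (y + z) = pm y + pm z := by
  ext k; rcases k with k | k <;> simp [pm]; ring

lemma pm_smul (c : ℝ) (y : Fin m → ℝ) : pm (c • y) = c • pm y := by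
  ext k; rcases k with k | k <;> simp [pm]

lemma abs_pm_le (y : Fin m → ℝ) (k : Fin m ⊕ Fin m) : |pm y k| ≤ ‖y‖ := by
  rcases k with k | k
  · exact norm_le_pi_norm y k
  · simp only [pm, Sum.elim_inr, Pi.neg_apply, abs_neg]; exact norm_le_pi_norm y k

/-- The map `u ↦ A u` into Euclidean space; `‖emb A u‖` is the norm of `u` induced by `AᵀA`. -/
def emb (A : Matrix (Fin m) (Fin d) ℝ) : (Fin d → ℝ) →ₗ[ℝ] EuclideanSpace ℝ (Fin m) :=
  (WithLp.linearEquiv 2 ℝ (Fin m → ℝ)).symm.toLinearMap ∘ₗ A.mulVecLin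

lemma emb_inner (A : Matrix (Fin m) (Fin d) ℝ) (u v : Fin d → ℝ) :
    inner ℝ (emb A u) (emb A v) = (A *ᵥ u) ⬝ᵥ (A *ᵥ v) := by
  simp [emb, PiLp.inner_apply, dotProduct, mul_comm]

lemma norm_sq_emb (A : Matrix (Fin m) (Fin d) ℝ) (u : Fin d → ℝ) :
    ‖emb A u‖ ^ 2 = (A *ᵥ u) ⬝ᵥ (A *ᵥ u) := by
  rw [← real_inner_self_eq_norm_sq, emb_inner]

lemma norm_mulVec_le (A : Matrix (Fin m) (Fin d) ℝ) (u : Fin d → ℝ) :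
    ‖A *ᵥ u‖ ≤ ‖emb A u‖ := by
  refine (pi_norm_le_iff_of_nonneg (norm_nonneg _)).2 fun i => ?_
  exact PiLp.norm_apply_le (emb A u) i

lemma matNorm_eq (A : Matrix (Fin m) (Fin d) ℝ) (u : Fin d → ℝ) :
    matNorm (Aᵀ * A) u = ‖emb A u‖ := by
  rw [matNorm, ← Matrix.mulVec_mulVec, Matrix.dotProduct_mulVec, Matrix.vecMul_transpose,
    ← norm_sq_emb, Real.sqrt_sq (norm_nonneg _)]

variable (A : Matrix (Fin m) (Fin d) ℝ) (b : Fin m → ℝ) (μ : ℝ)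

/-- The softmax weights of the `2 m` signed residuals at `x`. -/
def weights (x : Fin d → ℝ) : Fin m ⊕ Fin m → ℝ := gibbs μ (pm (A *ᵥ x - b))

/-- The derivative of the smooth objective at `x` in the direction `u`. -/
def slope (x u : Fin d → ℝ) : ℝ := mean (weights A b μ x) (pm (A *ᵥ u))

/-- The second derivative of the smooth objective at `x` in the directions `u` and `v`. -/
def curv (x u v : Fin d → ℝ) : ℝ :=
  1 / μ * cov (weights A b μ x) (pm (A *ᵥ u)) (pm (A *ᵥ v))

/-- The second derivative of `lam f_μ + ‖· - y‖² / 2`, the objective of a proximal step. -/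
def hess (lam : ℝ) (x u v : Fin d → ℝ) : ℝ :=
  lam * curv A b μ x u v + inner ℝ (emb A u) (emb A v)

/-- The derivative of `lam f_μ + ‖· - y‖² / 2` at `x` in the direction `v`. -/
def resid (lam : ℝ) (y x v : Fin d → ℝ) : ℝ :=
  lam * slope A b μ x v + inner ℝ (emb A (x - y)) (emb A v)

variable {A b μ}

lemma curv_comm (x u v : Fin d → ℝ) : curv A b μ x u v = curv A b μ x v u := by
  simp only [curv, cov_comm]

section Nonempty

variable [NeZero m]

lemma weights_nonneg (x : Fin d → ℝ) (k : Fin m ⊕ Fin m) : 0 ≤ weights A b μ x k :=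
  gibbs_nonneg _ _ _

lemma sum_weights (x : Fin d → ℝ) : ∑ k, weights A b μ x k = 1 := sum_gibbs _ _

lemma weights_add (x h : Fin d → ℝ) :
    weights A b μ (x + h) = tilt (weights A b μ x) (fun k => ((1 / μ) • pm (A *ᵥ h)) k) := by
  have : pm (A *ᵥ (x + h) - b) = pm (A *ᵥ x - b) + pm (A *ᵥ h) := by
    rw [← pm_add, Matrix.mulVec_add]; congr 1; abel
  rw [weights, this, gibbs_add]
  congr 1; ext k
  rw [Pi.smul_apply, smul_eq_mul, div_eq_inv_mul, one_div]

lemma curv_self_nonneg (hμ : 0 < μ) (x u : Fin d → ℝ) : 0 ≤ curv A b μ x u u :=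
  mul_nonneg (by positivity) (cov_self_nonneg (weights_nonneg x) _)

lemma curv_add_left (x u u' v : Fin d → ℝ) :
    curv A b μ x (u + u') v = curv A b μ x u v + curv A b μ x u' v := by
  simp only [curv, Matrix.mulVec_add, pm_add, cov_add_left (sum_weights x)]; ring

lemma curv_smul_left (c : ℝ) (x u v : Fin d → ℝ) :
    curv A b μ x (c • u) v = c * curv A b μ x u v := by
  simp only [curv, Matrix.mulVec_smul, pm_smul, cov_smul_left (sum_weights x)]; ring

lemma abs_curv_le (hμ : 0 < μ) (x u v : Fin d → ℝ) :
    |curv A b μ x u v| ≤ √(curv A b μ x u u) * √(curv A b μ x v v) := by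
  have h := abs_cov_le (weights_nonneg x) (w := weights A b μ x) (pm (A *ᵥ u)) (pm (A *ᵥ v))
  have h0 : (0 : ℝ) ≤ 1 / μ := by positivity
  simp only [curv]
  rw [abs_mul, abs_of_nonneg h0, Real.sqrt_mul h0, Real.sqrt_mul h0, mul_mul_mul_comm,
    Real.mul_self_sqrt h0]
  exact mul_le_mul_of_nonneg_left h h0

lemma curv_self_le (hμ : 0 < μ) (x u : Fin d → ℝ) :
    curv A b μ x u u ≤ ‖emb A u‖ ^ 2 / μ := by
  have h := cov_self_le (sum_weights x) (w := weights A b μ x) (pm (A *ᵥ u)) 0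
  have h2 : ∑ k, weights A b μ x k * (pm (A *ᵥ u) k - 0) ^ 2 ≤ ‖emb A u‖ ^ 2 := by
    calc _ ≤ ∑ k, weights A b μ x k * ‖emb A u‖ ^ 2 := by
          refine Finset.sum_le_sum fun k _ => mul_le_mul_of_nonneg_left ?_ (weights_nonneg x k)
          rw [sub_zero, sq_le_sq, abs_norm]
          exact (abs_pm_le _ k).trans (norm_mulVec_le A u)
      _ = _ := by rw [← Finset.sum_mul, sum_weights, one_mul]
  rw [curv, one_div, div_eq_inv_mul]
  exact mul_le_mul_of_nonneg_left (h.trans h2) (by positivity)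

lemma abs_slope_le (x u : Fin d → ℝ) : |slope A b μ x u| ≤ ‖emb A u‖ :=
  abs_mean_le (weights_nonneg x) (sum_weights x) fun k =>
    (abs_pm_le _ k).trans (norm_mulVec_le A u)

/-- Quasi-self-concordance: the Newton model of the slope has a small relative error as long as
`‖h‖` is a small multiple of the smoothing parameter `μ`. -/
lemma abs_slope_sub_le (hμ : 0 < μ) {τ : ℝ} (hτ : τ ≤ 1 / 2) {h : Fin d → ℝ}
    (hh : ‖emb A h‖ ≤ τ * μ) (x v : Fin d → ℝ) :
    |slope A b μ (x + h) v - slope A b μ x v - curv A b μ x h v| ≤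
      4 * τ * (√(curv A b μ x h h) * √(curv A b μ x v v)) := by
  set a := (1 / μ) • pm (A *ᵥ h) with ha
  have hab : ∀ k, |a k| ≤ τ := fun k => by
    have := (abs_pm_le (A *ᵥ h) k).trans ((norm_mulVec_le A h).trans hh)
    rw [ha, Pi.smul_apply, smul_eq_mul, abs_mul, abs_of_pos (by positivity : 0 < 1 / μ),
      one_div, inv_mul_le_iff₀ hμ, mul_comm]
    exact this
  have key := abs_mean_tilt_sub_le (weights_nonneg x) (sum_weights x) (w := weights A b μ x)
    hab hτ (pm (A *ᵥ v))
  have e1 : slope A b μ (x + h) v = mean (tilt (weights A b μ x) a) (pm (A *ᵥ v)) := by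
    rw [slope, weights_add]
  have e2 : curv A b μ x h v = cov (weights A b μ x) a (pm (A *ᵥ v)) := by
    rw [ha, cov_smul_left (sum_weights x), curv]
  have h0 : (0 : ℝ) ≤ 1 / μ := by positivity
  have e3 : √(cov (weights A b μ x) a a) * √(cov (weights A b μ x) (pm (A *ᵥ v)) (pm (A *ᵥ v))) =
      √(curv A b μ x h h) * √(curv A b μ x v v) := by
    rw [ha, cov_smul_left (sum_weights x), cov_comm, cov_smul_left (sum_weights x), curv, curv,
      Real.sqrt_mul h0, Real.sqrt_mul h0, Real.sqrt_mul h0]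
    ring
  rw [e1, e2, ← e3]
  exact key

lemma curv_self_le_add (hμ : 0 < μ) {h : Fin d → ℝ} (hh : ‖emb A h‖ ≤ μ / 16)
    (x v : Fin d → ℝ) :
    curv A b μ x v v ≤ 4 * curv A b μ (x + h) v v := by
  set a := (1 / μ) • pm (A *ᵥ h) with ha
  have hab : ∀ k, |a k| ≤ 1 / 16 := fun k => by
    have := (abs_pm_le (A *ᵥ h) k).trans ((norm_mulVec_le A h).trans hh)
    rw [ha, Pi.smul_apply, smul_eq_mul, abs_mul, abs_of_pos (by positivity : 0 < 1 / μ),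
      one_div, inv_mul_le_iff₀ hμ]
    linarith
  have key := cov_self_le_tilt (weights_nonneg x) (sum_weights x) (w := weights A b μ x)
    hab (pm (A *ᵥ v))
  have h0 : (0 : ℝ) ≤ 1 / μ := by positivity
  have he : Real.exp (2 * (1 / 16)) ≤ 4 := by
    have : Real.exp (2 * (1 / 16)) ≤ Real.exp 1 := Real.exp_le_exp.2 (by norm_num)
    linarith [Real.exp_one_lt_d9]
  have hn := cov_self_nonneg (weights_nonneg (x + h)) (w := weights A b μ (x + h)) (pm (A *ᵥ v))
  simp only [curv]
  rw [weights_add] at hn ⊢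
  calc _ ≤ 1 / μ * (4 * cov (tilt (weights A b μ x) a) (pm (A *ᵥ v)) (pm (A *ᵥ v))) :=
        mul_le_mul_of_nonneg_left (key.trans (mul_le_mul_of_nonneg_right he hn)) h0
    _ = _ := by ring

/-! ### Newton's method for the proximal objective -/

lemma norm_sq_le_hess (hμ : 0 < μ) {lam : ℝ} (hl : 0 ≤ lam) (x u : Fin d → ℝ) :
    ‖emb A u‖ ^ 2 ≤ hess A b μ lam x u u := by
  rw [hess, real_inner_self_eq_norm_sq]
  have := mul_nonneg hl (curv_self_nonneg (A := A) (b := b) hμ x u)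
  linarith

lemma hess_self_nonneg (hμ : 0 < μ) {lam : ℝ} (hl : 0 ≤ lam) (x u : Fin d → ℝ) :
    0 ≤ hess A b μ lam x u u :=
  (sq_nonneg _).trans (norm_sq_le_hess hμ hl x u)

lemma abs_hess_le (hμ : 0 < μ) {lam : ℝ} (hl : 0 ≤ lam) (x u v : Fin d → ℝ) :
    |hess A b μ lam x u v| ≤ √(hess A b μ lam x u u) * √(hess A b μ lam x v v) := by
  set c := hess A b μ lam x u u
  set e := hess A b μ lam x v v
  set f := hess A b μ lam x u v
  have hq : ∀ t : ℝ, 0 ≤ c * (t * t) + 2 * f * t + e := fun t => by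
    have h0 := hess_self_nonneg (A := A) (b := b) hμ hl x (t • u + v)
    have : hess A b μ lam x (t • u + v) (t • u + v) = c * (t * t) + 2 * f * t + e := by
      simp only [hess, c, e, f, curv_add_left, curv_smul_left, map_add, map_smul, inner_add_left,
        inner_add_right, inner_smul_left, inner_smul_right]
      rw [curv_comm x u (t • u + v), curv_comm x v (t • u + v)]
      simp only [curv_add_left, curv_smul_left]
      rw [curv_comm x v u, real_inner_comm (emb A u) (emb A v)]
      simp; ring
    linarith
  have hd := discrim_le_zero hq
  rw [discrim] at hd
  rw [← Real.sqrt_mul (hess_self_nonneg hμ hl x u)]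
  exact Real.abs_le_sqrt (by nlinarith)

/-- Quadratic convergence of Newton's method, weakened to a linear rate: if the Newton step `h` at
`x` is short, the Newton step at `x + h` is at most half as long, in the respective local norms. -/
lemma newton_decrement_le (hμ : 0 < μ) {lam : ℝ} (hl : 0 ≤ lam) {x y h h' : Fin d → ℝ}
    (hN : ∀ v, hess A b μ lam x h v = -resid A b μ lam y x v)
    (hN' : ∀ v, hess A b μ lam (x + h) h' v = -resid A b μ lam y (x + h) v)
    (hs : √(hess A b μ lam x h h) ≤ μ / 16) :
    √(hess A b μ lam (x + h) h' h') ≤ √(hess A b μ lam x h h) / 2 := by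
  set δ := √(hess A b μ lam x h h) with hδ
  set δ' := √(hess A b μ lam (x + h) h' h') with hδ'
  have hδ0 : 0 ≤ δ := Real.sqrt_nonneg _
  have hδ'0 : 0 ≤ δ' := Real.sqrt_nonneg _
  have hhδ : ‖emb A h‖ ≤ δ := Real.le_sqrt_of_sq_le (norm_sq_le_hess hμ hl x h)
  have hh : ‖emb A h‖ ≤ μ / 16 := hhδ.trans hs
  have key := abs_slope_sub_le (A := A) (b := b) hμ (τ := 1 / 16) (by norm_num)
    (by linarith : ‖emb A h‖ ≤ 1 / 16 * μ) x h'
  have c1 : √lam * √(curv A b μ x h h) ≤ δ := by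
    rw [← Real.sqrt_mul hl]
    refine Real.sqrt_le_sqrt ?_
    rw [hess, real_inner_self_eq_norm_sq]; nlinarith [sq_nonneg ‖emb A h‖]
  have c2 : √lam * √(curv A b μ x h' h') ≤ 2 * δ' := by
    rw [← Real.sqrt_mul hl]
    have : (2 : ℝ) = √4 := by rw [show (4 : ℝ) = 2 ^ 2 by norm_num, Real.sqrt_sq (by norm_num)]
    rw [hδ', this, ← Real.sqrt_mul (by norm_num)]
    refine Real.sqrt_le_sqrt ?_
    have := mul_le_mul_of_nonneg_left (curv_self_le_add (b := b) hμ hh x h') hl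
    rw [hess, real_inner_self_eq_norm_sq]
    nlinarith [sq_nonneg ‖emb A h'‖]
  have e1 : δ' ^ 2 = -(lam * (slope A b μ (x + h) h' - slope A b μ x h' - curv A b μ x h h')) := by
    rw [hδ', Real.sq_sqrt (hess_self_nonneg hμ hl _ _), hN' h']
    have := hN h'
    simp only [hess, resid, map_sub, map_add, inner_sub_left, inner_add_left] at this ⊢
    linarith
  have e2 : δ' ^ 2 ≤ lam * (4 * (1 / 16) * (√(curv A b μ x h h) * √(curv A b μ x h' h'))) := by
    rw [e1, ← mul_neg]
    exact mul_le_mul_of_nonneg_left ((neg_le_abs _).trans key) hl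
  have e3 : δ' ^ 2 ≤ 1 / 4 * (δ * (2 * δ')) := by
    calc δ' ^ 2 ≤ 1 / 4 * ((√lam * √(curv A b μ x h h)) * (√lam * √(curv A b μ x h' h'))) := by
          rw [mul_mul_mul_comm (√lam), Real.mul_self_sqrt hl]; linarith
      _ ≤ _ := by gcongr
  rcases hδ'0.eq_or_lt with h0 | h0
  · rw [← h0]; positivity
  · nlinarith

end Nonempty

end Model

/-! ### Newton steps through linear systems -/

section Solve

variable {m d : ℕ} {A : Matrix (Fin m) (Fin d) ℝ}

lemma mulVec_eq_zero_of_posDef (hA : (Aᵀ * A).PosDef) (v : Fin d → ℝ) (hv : A *ᵥ v = 0) :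
    v = 0 := by
  have h : (Aᵀ * A) *ᵥ v = 0 := by rw [← Matrix.mulVec_mulVec, hv, Matrix.mulVec_zero]
  by_contra hne
  exact hA.det_pos.ne' (Matrix.exists_mulVec_eq_zero_iff.1 ⟨v, hne, h⟩)

lemma dotProduct_weighted_gram (D : Fin m → ℝ) (u v : Fin d → ℝ) :
    ((Aᵀ * Matrix.diagonal D * A) *ᵥ u) ⬝ᵥ v = ∑ i, D i * ((A *ᵥ u) i * (A *ᵥ v) i) := by
  rw [← Matrix.mulVec_mulVec, ← Matrix.mulVec_mulVec, Matrix.mulVec_transpose,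
    ← Matrix.dotProduct_mulVec]
  simp [dotProduct, Matrix.mulVec_diagonal, mul_assoc]

/-- The weak form of a linear system `Aᵀ D A φ = w` with positive `D`. -/
lemma sum_solve_eq (hA : (Aᵀ * A).PosDef) {D : Fin m → ℝ} (hD : ∀ i, 0 < D i) (w v : Fin d → ℝ) :
    ∑ i, D i * ((A *ᵥ ((Aᵀ * Matrix.diagonal D * A)⁻¹ *ᵥ w)) i * (A *ᵥ v) i) = w ⬝ᵥ v := by
  have hdet : IsUnit (Aᵀ * Matrix.diagonal D * A).det := by
    rw [isUnit_iff_ne_zero]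
    intro h0
    obtain ⟨u, hu, hu0⟩ := Matrix.exists_mulVec_eq_zero_iff.2 h0
    have h := dotProduct_weighted_gram (A := A) D u u
    rw [hu0, zero_dotProduct, eq_comm, Finset.sum_eq_zero_iff_of_nonneg
      (fun i _ => mul_nonneg (hD i).le (mul_self_nonneg _))] at h
    refine hu (mulVec_eq_zero_of_posDef hA u (funext fun i => ?_))
    have := h i (Finset.mem_univ i)
    simpa [(hD i).ne'] using this
  rw [← dotProduct_weighted_gram, Matrix.mulVec_mulVec, Matrix.mul_nonsing_inv _ hdet,
    Matrix.one_mulVec]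

variable (A) (b : Fin m → ℝ) (μ : ℝ)

/-- The gradient of the smooth objective, in coordinates. -/
def gradVec (x : Fin d → ℝ) : Fin d → ℝ :=
  Aᵀ *ᵥ fun i => weights A b μ x (Sum.inl i) - weights A b μ x (Sum.inr i)

/-- The gradient of the smooth objective with respect to the inner product given by `AᵀA`. -/
def rieszGrad (x : Fin d → ℝ) : Fin d → ℝ :=
  (Aᵀ * Matrix.diagonal (fun _ : Fin m => (1 : ℝ)) * A)⁻¹ *ᵥ gradVec A b μ x

/-- The diagonal part of the Hessian of `lam f_μ + ‖· - y‖² / 2`, which is the matrix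
`Aᵀ D A - (lam / μ) g gᵀ` with `g` the gradient of `f_μ`. -/
def diagWeights (lam : ℝ) (x : Fin d → ℝ) : Fin m → ℝ :=
  fun i => lam / μ * (weights A b μ x (Sum.inl i) + weights A b μ x (Sum.inr i)) + 1

/-- One Newton step for `lam f_μ + ‖· - y‖² / 2`. The rank-one part of the Hessian is handled by
the Sherman–Morrison formula, at the price of a second linear system. -/
def newtonStep (lam : ℝ) (y x : Fin d → ℝ) : Fin d → ℝ :=
  let g := gradVec A b μ x
  let M := (Aᵀ * Matrix.diagonal (diagWeights A b μ lam x) * A)⁻¹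
  let p := M *ᵥ (lam • g + Aᵀ *ᵥ (A *ᵥ (x - y)))
  let q := M *ᵥ g
  x - (p + (lam / μ * (g ⬝ᵥ p) / (1 - lam / μ * (g ⬝ᵥ q))) • q)

variable {A b μ}

lemma gradVec_dotProduct (x u : Fin d → ℝ) : gradVec A b μ x ⬝ᵥ u = slope A b μ x u := by
  rw [gradVec, Matrix.mulVec_transpose, ← Matrix.dotProduct_mulVec]
  simp [slope, mean, pm, dotProduct, sub_mul, Finset.sum_sub_distrib, ← sub_eq_add_neg]

lemma inner_rieszGrad (hA : (Aᵀ * A).PosDef) (x v : Fin d → ℝ) :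
    inner ℝ (emb A (rieszGrad A b μ x)) (emb A v) = slope A b μ x v := by
  have := sum_solve_eq hA (D := fun _ => 1) (fun _ => one_pos) (gradVec A b μ x) v
  rw [gradVec_dotProduct] at this
  rw [emb_inner, ← this]
  simp only [dotProduct, rieszGrad, one_mul]

variable [NeZero m]

lemma grad_smoothObjective (hμ : 0 < μ) (x : Fin d → ℝ) :
    grad (smoothObjective A b μ) x = gradVec A b μ x := by
  have hS := sum_exp_pos μ (pm (A *ᵥ x - b))
  let ℓ : Fin m ⊕ Fin m → (Fin d → ℝ) →L[ℝ] ℝ := fun k =>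
    LinearMap.toContinuousLinearMap
      { toFun := fun u => pm (A *ᵥ u) k
        map_add' := fun u v => by rw [Matrix.mulVec_add, pm_add]; rfl
        map_smul' := fun c u => by rw [Matrix.mulVec_smul, pm_smul]; rfl }
  have hz : ∀ k, HasFDerivAt (fun x => pm (A *ᵥ x - b) k / μ) ((1 / μ) • ℓ k) x := fun k => by
    have e : (fun x => pm (A *ᵥ x - b) k / μ) = fun x => (1 / μ) • (ℓ k x) + pm (-b) k / μ := by
      funext x
      rw [sub_eq_add_neg, pm_add]
      simp only [Pi.add_apply, smul_eq_mul, ℓ, LinearMap.coe_toContinuousLinearMap',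
        LinearMap.coe_mk, AddHom.coe_mk]
      ring
    rw [e]
    exact ((ℓ k).hasFDerivAt.const_smul (1 / μ)).add_const _
  have hF := ((HasFDerivAt.fun_sum fun k (_ : k ∈ Finset.univ) => (hz k).exp).log hS.ne').const_mul μ
  have hF' : HasFDerivAt (smoothObjective A b μ) _ x := hF
  funext i
  rw [grad, hF'.fderiv]
  have := gradVec_dotProduct (A := A) (b := b) (μ := μ) x (Pi.single i 1)
  rw [dotProduct_single_one] at this
  rw [this, slope, mean]
  simp only [smul_apply, sum_apply, smul_eq_mul,
    Finset.mul_sum, weights, gibbs, ℓ, LinearMap.coe_toContinuousLinearMap', LinearMap.coe_mk,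
    AddHom.coe_mk]
  refine Finset.sum_congr rfl fun k _ => ?_
  field_simp

/-- The smooth objective lies above its linearisation. -/
lemma smoothObjective_add_slope_le (hμ : 0 < μ) (x z : Fin d → ℝ) :
    smoothObjective A b μ x + slope A b μ x (z - x) ≤ smoothObjective A b μ z := by
  have h := smax_add_mean_le hμ (pm (A *ᵥ x - b)) (pm (A *ᵥ z - b))
  have e : pm (A *ᵥ z - b) - pm (A *ᵥ x - b) = pm (A *ᵥ (z - x)) := by
    rw [sub_eq_iff_eq_add, ← pm_add, Matrix.mulVec_sub]; congr 1; abel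
  rw [e] at h
  exact h

lemma hess_eq_sum_sub (lam : ℝ) (x u v : Fin d → ℝ) :
    hess A b μ lam x u v =
      ∑ i, diagWeights A b μ lam x i * ((A *ᵥ u) i * (A *ᵥ v) i)
        - lam / μ * (slope A b μ x u * slope A b μ x v) := by
  have e : ∀ i, diagWeights A b μ lam x i * ((A *ᵥ u) i * (A *ᵥ v) i) =
      lam / μ * (weights A b μ x (Sum.inl i) * ((A *ᵥ u) i * (A *ᵥ v) i)) +
      lam / μ * (weights A b μ x (Sum.inr i) * ((A *ᵥ u) i * (A *ᵥ v) i)) +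
      (A *ᵥ u) i * (A *ᵥ v) i := fun i => by rw [diagWeights]; ring
  rw [hess, curv, cov_eq (sum_weights x), emb_inner]
  simp only [e, Finset.sum_add_distrib, ← Finset.mul_sum, slope]
  have : mean (weights A b μ x) (pm (A *ᵥ u) * pm (A *ᵥ v)) =
      ∑ i, weights A b μ x (Sum.inl i) * ((A *ᵥ u) i * (A *ᵥ v) i) +
      ∑ i, weights A b μ x (Sum.inr i) * ((A *ᵥ u) i * (A *ᵥ v) i) := by
    simp [mean, pm]
  rw [this, dotProduct]
  ring

lemma diagWeights_pos (hμ : 0 < μ) {lam : ℝ} (hl : 0 ≤ lam) (x : Fin d → ℝ) (i : Fin m) :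
    0 < diagWeights A b μ lam x i := by
  have h1 := weights_nonneg (A := A) (b := b) (μ := μ) x (Sum.inl i)
  have h2 := weights_nonneg (A := A) (b := b) (μ := μ) x (Sum.inr i)
  rw [diagWeights]; positivity

/-- `newtonStep` solves the Newton equation. -/
lemma hess_newtonStep (hA : (Aᵀ * A).PosDef) (hμ : 0 < μ) {lam : ℝ} (hl : 0 ≤ lam)
    (y x v : Fin d → ℝ) :
    hess A b μ lam x (newtonStep A b μ lam y x - x) v = -resid A b μ lam y x v := by
  set g := gradVec A b μ x with hg
  set M := (Aᵀ * Matrix.diagonal (diagWeights A b μ lam x) * A)⁻¹ with hM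
  set p := M *ᵥ (lam • g + Aᵀ *ᵥ (A *ᵥ (x - y))) with hp
  set q := M *ᵥ g with hq
  set c := lam / μ * (g ⬝ᵥ p) / (1 - lam / μ * (g ⬝ᵥ q)) with hc
  have hstep : newtonStep A b μ lam y x - x = -(p + c • q) := by
    simp only [newtonStep, ← hg, ← hM, ← hp, ← hq, ← hc]; abel
  have hD := diagWeights_pos (A := A) (b := b) hμ hl x
  have hgs : ∀ u, g ⬝ᵥ u = slope A b μ x u := gradVec_dotProduct x
  have hsolve := fun w u => sum_solve_eq hA hD w u
  have hpu : ∀ u, hess A b μ lam x p u =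
      resid A b μ lam y x u - lam / μ * (g ⬝ᵥ p) * (g ⬝ᵥ u) := fun u => by
    rw [hess_eq_sum_sub, hp, hsolve, add_dotProduct, smul_dotProduct, Matrix.mulVec_transpose,
      ← Matrix.dotProduct_mulVec, resid, emb_inner, hgs, hgs, smul_eq_mul]
    ring
  have hqu : ∀ u, hess A b μ lam x q u = (1 - lam / μ * (g ⬝ᵥ q)) * (g ⬝ᵥ u) := fun u => by
    rw [hess_eq_sum_sub, hq, hsolve, ← hq, ← hgs, ← hgs]; ring
  -- The Hessian is positive definite, so the Sherman–Morrison denominator cannot vanish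
  -- unless `q = 0`, in which case it is `1`.
  have hden : 1 - lam / μ * (g ⬝ᵥ q) ≠ 0 := by
    intro h0
    have h1 := norm_sq_le_hess (A := A) (b := b) hμ hl x q
    rw [hqu, h0, zero_mul, norm_sq_emb] at h1
    have hAq : A *ᵥ q = 0 := dotProduct_self_eq_zero.1 (le_antisymm h1
      (by rw [← norm_sq_emb]; positivity))
    rw [mulVec_eq_zero_of_posDef hA q hAq] at h0
    simp at h0
  have hlin : hess A b μ lam x (-(p + c • q)) v =
      -(hess A b μ lam x p v + c * hess A b μ lam x q v) := by
    rw [← neg_one_smul ℝ (p + c • q)]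
    simp only [hess, curv_add_left, curv_smul_left, map_add, map_smul, inner_add_left,
      inner_smul_left, RCLike.conj_to_real]
    ring
  have hcc : c * (1 - lam / μ * (g ⬝ᵥ q)) = lam / μ * (g ⬝ᵥ p) := by
    rw [hc]; exact div_mul_cancel₀ _ hden
  rw [hstep, hlin, hpu, hqu]
  linear_combination (-(g ⬝ᵥ v)) * hcc

end Solve

/-! ### Following the path of proximal points -/

section Path

variable {m d : ℕ} (A : Matrix (Fin m) (Fin d) ℝ) (b : Fin m → ℝ) (μ : ℝ)

/-- The gradient of `lam f_μ + ‖· - y‖² / 2` at `t` with respect to the inner product given by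
`AᵀA`. -/
def proxErr (lam : ℝ) (y t : Fin d → ℝ) : Fin d → ℝ := lam • rieszGrad A b μ t + (t - y)

/-- `t` is an approximate minimiser of `lam f_μ + ‖· - y‖² / 2`, with an error that is small
relative to the displacement `t - y`: the acceptance criterion of Monteiro and Svaiter. -/
def IsApproxProx (lam : ℝ) (y t : Fin d → ℝ) : Prop :=
  ‖emb A (proxErr A b μ lam y t)‖ ≤ ‖emb A (t - y)‖ / 4

/-- The geometric grid of proximal step sizes. -/
def grid (i : ℕ) : ℝ := μ / 16 * 2 ^ i

/-- Candidates for the proximal points of `y` along the grid of step sizes: a gradient step for the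
smallest step size, then `n` Newton steps for each further one, starting at the previous point. -/
def proxPath (n : ℕ) (y : Fin d → ℝ) : ℕ → Fin d → ℝ
  | 0 => y - (μ / 16) • rieszGrad A b μ y
  | i + 1 => (newtonStep A b μ (grid μ (i + 1)) y)^[n] (proxPath n y i)

variable {A b μ}

lemma grid_pos (hμ : 0 < μ) (i : ℕ) : 0 < grid μ i := by unfold grid; positivity

lemma grid_succ (i : ℕ) : grid μ (i + 1) = 2 * grid μ i := by unfold grid; ring

lemma grid_mono (hμ : 0 < μ) : Monotone (grid μ) :=
  monotone_nat_of_le_succ fun i => by rw [grid_succ]; linarith [grid_pos hμ i]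

lemma inner_proxErr (hA : (Aᵀ * A).PosDef) (lam : ℝ) (y t v : Fin d → ℝ) :
    inner ℝ (emb A (proxErr A b μ lam y t)) (emb A v) = resid A b μ lam y t v := by
  rw [proxErr, map_add, map_smul, inner_add_left, inner_smul_left, inner_rieszGrad hA, resid]
  simp

variable [NeZero m]

lemma slope_mono (hμ : 0 < μ) (p q : Fin d → ℝ) :
    slope A b μ p (q - p) ≤ slope A b μ q (q - p) := by
  have h1 := smoothObjective_add_slope_le (A := A) (b := b) hμ p q
  have h2 := smoothObjective_add_slope_le (A := A) (b := b) hμ q p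
  have h3 : slope A b μ q (p - q) = -slope A b μ q (q - p) := by
    rw [← neg_sub q p, ← neg_one_smul ℝ (q - p), slope, Matrix.mulVec_smul, pm_smul, mean_smul,
      slope]; ring
  linarith

lemma norm_rieszGrad_le (hA : (Aᵀ * A).PosDef) (x : Fin d → ℝ) :
    ‖emb A (rieszGrad A b μ x)‖ ≤ 1 := by
  have h := abs_slope_le (A := A) (b := b) (μ := μ) x (rieszGrad A b μ x)
  rw [← inner_rieszGrad hA, real_inner_self_eq_norm_sq] at h
  have := (le_abs_self _).trans h
  nlinarith [norm_nonneg (emb A (rieszGrad A b μ x))]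

/-- For the smallest step size a gradient step is an approximate proximal step, because the
gradient is Lipschitz continuous with a constant of order `1 / μ`. -/
lemma isApproxProx_proxPath_zero (hA : (Aᵀ * A).PosDef) (hμ : 0 < μ) (n : ℕ) (y : Fin d → ℝ) :
    IsApproxProx A b μ (grid μ 0) y (proxPath A b μ n y 0) := by
  set h := -((μ / 16) • rieszGrad A b μ y) with hh
  have ht : proxPath A b μ n y 0 = y + h := by rw [hh, proxPath]; abel
  have hn : ‖emb A h‖ ≤ μ / 16 := by
    rw [hh, map_neg, norm_neg, map_smul, norm_smul, Real.norm_of_nonneg (by positivity)]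
    have := norm_rieszGrad_le (b := b) (μ := μ) hA y
    nlinarith
  set e := proxErr A b μ (grid μ 0) y (y + h) with he
  rw [IsApproxProx, ht, ← he, add_sub_cancel_left]
  have e1 : ‖emb A e‖ ^ 2 = μ / 16 * (slope A b μ (y + h) e - slope A b μ y e) := by
    rw [← real_inner_self_eq_norm_sq]
    nth_rw 1 [he]
    rw [inner_proxErr hA, resid, add_sub_cancel_left]
    rw [hh, map_neg, map_smul, inner_neg_left, inner_smul_left, inner_rieszGrad hA, ← hh]
    simp [grid]; ring
  have e2 := abs_slope_sub_le (A := A) (b := b) hμ (τ := 1 / 16) (by norm_num)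
    (by linarith : ‖emb A h‖ ≤ 1 / 16 * μ) y e
  have e3 := abs_curv_le (A := A) (b := b) hμ y h e
  have e4 : √(curv A b μ y h h) * √(curv A b μ y e e) ≤ ‖emb A h‖ * ‖emb A e‖ / μ := by
    rw [← Real.sqrt_mul (curv_self_nonneg hμ _ _)]
    refine Real.sqrt_le_iff.2 ⟨by positivity, ?_⟩
    calc _ ≤ ‖emb A h‖ ^ 2 / μ * (‖emb A e‖ ^ 2 / μ) :=
          mul_le_mul (curv_self_le hμ _ _) (curv_self_le hμ _ _) (curv_self_nonneg hμ _ _)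
            (by positivity)
      _ = _ := by ring
  have e5 : slope A b μ (y + h) e - slope A b μ y e ≤ 5 / 4 * (‖emb A h‖ * ‖emb A e‖ / μ) := by
    have h1 := (abs_le.1 e2).2
    have h2 := (abs_le.1 e3).2
    linarith
  have e6 : ‖emb A e‖ ^ 2 ≤ ‖emb A h‖ / 4 * ‖emb A e‖ := by
    calc ‖emb A e‖ ^ 2 ≤ μ / 16 * (5 / 4 * (‖emb A h‖ * ‖emb A e‖ / μ)) := by
          rw [e1]; exact mul_le_mul_of_nonneg_left e5 (by positivity)
      _ = 5 / 64 * (‖emb A h‖ * ‖emb A e‖) := by field_simp; ring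
      _ ≤ _ := by nlinarith [mul_nonneg (norm_nonneg (emb A h)) (norm_nonneg (emb A e))]
  rcases (norm_nonneg (emb A e)).eq_or_lt with h0 | h0
  · rw [← h0]; positivity
  · nlinarith

/-- The length of the Newton step at `x` in the local norm. -/
lemma sqrt_hess_newtonStep_le (hA : (Aᵀ * A).PosDef) (hμ : 0 < μ) {lam : ℝ} (hl : 0 ≤ lam)
    (y x : Fin d → ℝ) :
    √(hess A b μ lam x (newtonStep A b μ lam y x - x) (newtonStep A b μ lam y x - x)) ≤
      ‖emb A (proxErr A b μ lam y x)‖ := by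
  set h := newtonStep A b μ lam y x - x with hh
  set δ := √(hess A b μ lam x h h) with hδ
  have h1 : δ ^ 2 = -inner ℝ (emb A (proxErr A b μ lam y x)) (emb A h) := by
    rw [hδ, Real.sq_sqrt (hess_self_nonneg hμ hl _ _), hh, hess_newtonStep hA hμ hl,
      inner_proxErr hA]
  have h2 : ‖emb A h‖ ≤ δ := Real.le_sqrt_of_sq_le (norm_sq_le_hess hμ hl x h)
  have h3 := abs_real_inner_le_norm (emb A (proxErr A b μ lam y x)) (emb A h)
  have h4 := (abs_le.1 h3).1
  rcases (Real.sqrt_nonneg (hess A b μ lam x h h)).eq_or_lt with h0 | h0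
  · rw [hδ, ← h0]; positivity
  · have := mul_le_mul_of_nonneg_left h2 (norm_nonneg (emb A (proxErr A b μ lam y x)))
    rw [← hδ] at h0
    nlinarith

/-- Conversely the error is controlled by the Newton step, up to the condition number of the
Hessian. -/
lemma norm_proxErr_le (hA : (Aᵀ * A).PosDef) (hμ : 0 < μ) {lam : ℝ} (hl : 0 ≤ lam)
    (y x : Fin d → ℝ) :
    ‖emb A (proxErr A b μ lam y x)‖ ≤ √(1 + lam / μ) *
      √(hess A b μ lam x (newtonStep A b μ lam y x - x) (newtonStep A b μ lam y x - x)) := by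
  set h := newtonStep A b μ lam y x - x with hh
  set δ := √(hess A b μ lam x h h) with hδ
  set e := proxErr A b μ lam y x with he
  have h1 : ‖emb A e‖ ^ 2 = -hess A b μ lam x h e := by
    rw [← real_inner_self_eq_norm_sq]
    nth_rw 1 [he]
    rw [inner_proxErr hA, hh, hess_newtonStep hA hμ hl, neg_neg]
  have h2 : √(hess A b μ lam x e e) ≤ √(1 + lam / μ) * ‖emb A e‖ := by
    rw [← Real.sqrt_sq (norm_nonneg (emb A e)), ← Real.sqrt_mul (by positivity)]
    refine Real.sqrt_le_sqrt ?_
    rw [hess, real_inner_self_eq_norm_sq]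
    have := mul_le_mul_of_nonneg_left (curv_self_le (A := A) (b := b) hμ x e) hl
    calc _ ≤ lam * (‖emb A e‖ ^ 2 / μ) + ‖emb A e‖ ^ 2 := by linarith
      _ = _ := by ring
  have h3 := (abs_le.1 (abs_hess_le (A := A) (b := b) hμ hl x h e)).1
  have h4 : ‖emb A e‖ ^ 2 ≤ √(1 + lam / μ) * δ * ‖emb A e‖ := by
    have := mul_le_mul_of_nonneg_left h2 (Real.sqrt_nonneg (hess A b μ lam x h h))
    rw [← hδ] at this h3
    nlinarith
  rcases (norm_nonneg (emb A e)).eq_or_lt with h0 | h0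
  · rw [← h0]; positivity
  · nlinarith

lemma sqrt_hess_iterate_le (hA : (Aᵀ * A).PosDef) (hμ : 0 < μ) {lam : ℝ} (hl : 0 ≤ lam)
    (y t : Fin d → ℝ) (h0 : ‖emb A (proxErr A b μ lam y t)‖ ≤ μ / 16) (k : ℕ) :
    let x := (newtonStep A b μ lam y)^[k] t
    √(hess A b μ lam x (newtonStep A b μ lam y x - x) (newtonStep A b μ lam y x - x)) ≤
      ‖emb A (proxErr A b μ lam y t)‖ / 2 ^ k := by
  induction k with
  | zero => simpa using sqrt_hess_newtonStep_le hA hμ hl y t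
  | succ k ih =>
    simp only [Function.iterate_succ_apply']
    set x := (newtonStep A b μ lam y)^[k] t with hx
    set x' := newtonStep A b μ lam y x with hx'
    have hxx : x + (x' - x) = x' := by abel
    have hle : ‖emb A (proxErr A b μ lam y t)‖ / 2 ^ k ≤ μ / 16 :=
      (div_le_self (norm_nonneg _) (one_le_pow₀ (by norm_num))).trans h0
    have := newton_decrement_le (A := A) (b := b) hμ hl (x := x) (y := y) (h := x' - x)
      (h' := newtonStep A b μ lam y x' - x') (hess_newtonStep hA hμ hl y x)
      (by rw [hxx]; exact hess_newtonStep hA hμ hl y x') (ih.trans hle)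
    rw [hxx] at this
    refine this.trans ?_
    rw [pow_succ, ← div_div]
    exact div_le_div_of_nonneg_right ih (by norm_num)

/-- Doubling the step size: an approximate proximal point with a displacement of at most `μ / 32`
is close enough to the next one for Newton's method to converge. -/
lemma isApproxProx_iterate (hA : (Aᵀ * A).PosDef) (hμ : 0 < μ) {lam : ℝ} (hl : 0 ≤ lam)
    {y t : Fin d → ℝ} (ht : IsApproxProx A b μ lam y t) (hd : ‖emb A (t - y)‖ ≤ μ / 32) {n : ℕ}
    (hn : 32 * √(1 + 2 * lam / μ) ≤ 2 ^ n) :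
    IsApproxProx A b μ (2 * lam) y ((newtonStep A b μ (2 * lam) y)^[n] t) := by
  set t' := (newtonStep A b μ (2 * lam) y)^[n] t with ht'
  set p := t - y with hp
  set q := t' - y with hq
  set e := proxErr A b μ lam y t with he
  set e' := proxErr A b μ (2 * lam) y t' with he'
  have hl2 : 0 ≤ 2 * lam := by positivity
  have hin : ‖emb A e‖ ≤ ‖emb A p‖ / 4 := ht
  have hstart : ‖emb A (proxErr A b μ (2 * lam) y t)‖ ≤ 2 * ‖emb A p‖ := by
    have : proxErr A b μ (2 * lam) y t = (2 : ℝ) • e - p := by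
      simp only [he, hp, proxErr, smul_add, smul_smul, two_smul]; abel
    rw [this, map_sub, map_smul]
    refine (norm_sub_le _ _).trans ?_
    rw [norm_smul, Real.norm_two]
    linarith [norm_nonneg (emb A p)]
  have hsmall : ‖emb A e'‖ ≤ ‖emb A p‖ / 16 := by
    refine (norm_proxErr_le hA hμ hl2 y t').trans ?_
    have h1 := sqrt_hess_iterate_le hA hμ hl2 y t (hstart.trans (by linarith)) n
    have h2 := h1.trans (div_le_div_of_nonneg_right hstart (by positivity))
    refine (mul_le_mul_of_nonneg_left h2 (Real.sqrt_nonneg _)).trans ?_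
    rw [mul_div_assoc', div_le_iff₀ (by positivity)]
    nlinarith [mul_le_mul_of_nonneg_left hn (norm_nonneg (emb A p))]
  -- The displacement cannot shrink much, by the monotonicity of the gradient.
  have hmono : 0 ≤ inner ℝ (emb A ((2 : ℝ) • p - q + e' - (2 : ℝ) • e)) (emb A (q - p)) := by
    have h1 := slope_mono (A := A) (b := b) hμ t t'
    have h2 : q - p = t' - t := by rw [hp, hq]; abel
    rw [← inner_rieszGrad hA, ← inner_rieszGrad hA] at h1
    have h3 : (2 : ℝ) • p - q + e' - (2 : ℝ) • e =
        (2 * lam) • (rieszGrad A b μ t' - rieszGrad A b μ t) := by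
      simp only [he, he', hp, hq, proxErr, smul_add, smul_sub, smul_smul]; abel
    rw [h2, h3, map_smul, inner_smul_left, map_sub, inner_sub_left]
    exact mul_nonneg (by simpa using hl2) (by linarith)
  have hbig : ‖emb A p‖ / 4 ≤ ‖emb A q‖ := by
    by_contra! hlt
    simp only [map_add, map_sub, map_smul] at hmono
    set P := emb A p
    set Q := emb A q
    have e1 : inner ℝ ((2 : ℝ) • P - Q + emb A e' - (2 : ℝ) • emb A e) (Q - P) =
        3 * inner ℝ P Q - 2 * ‖P‖ ^ 2 - ‖Q‖ ^ 2
          + inner ℝ (emb A e' - (2 : ℝ) • emb A e) (Q - P) := by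
      rw [← real_inner_self_eq_norm_sq, ← real_inner_self_eq_norm_sq]
      simp only [inner_sub_left, inner_sub_right, inner_add_left, inner_smul_left,
        RCLike.conj_to_real, real_inner_comm P Q]
      ring
    have h1 : ‖emb A e' - (2 : ℝ) • emb A e‖ ≤ 9 / 16 * ‖P‖ := by
      refine (norm_sub_le _ _).trans ?_
      rw [norm_smul, Real.norm_two]; linarith
    have h2 := real_inner_le_norm (emb A e' - (2 : ℝ) • emb A e) (Q - P)
    have h3 := norm_sub_le Q P
    have h4 := real_inner_le_norm P Q
    have h5 : ‖emb A e' - (2 : ℝ) • emb A e‖ * ‖Q - P‖ ≤ 9 / 16 * ‖P‖ * (‖Q‖ + ‖P‖) :=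
      mul_le_mul h1 h3 (norm_nonneg _) (by positivity)
    have hP : 0 < ‖P‖ := by linarith [norm_nonneg Q]
    nlinarith [norm_nonneg Q, mul_pos hP (sub_pos.2 hlt), mul_nonneg hP.le (norm_nonneg Q)]
  exact hsmall.trans (by linarith)

/-- The path reaches the step size `grid μ j`, or it leaves the ball of radius `μ / 32` about `y`
at a smaller step size; up to there all its points are approximate proximal points. -/
lemma exists_isApproxProx (hA : (Aᵀ * A).PosDef) (hμ : 0 < μ) {n : ℕ} (y : Fin d → ℝ) (j : ℕ)
    (hn : 32 * √(1 + grid μ j / μ) ≤ 2 ^ n) :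
    ∃ i ≤ j, IsApproxProx A b μ (grid μ i) y (proxPath A b μ n y i) ∧
      (i < j → μ / 32 < ‖emb A (proxPath A b μ n y i - y)‖) := by
  induction j with
  | zero => exact ⟨0, le_rfl, isApproxProx_proxPath_zero hA hμ n y, by simp⟩
  | succ j ih =>
    have hn' : 32 * √(1 + grid μ j / μ) ≤ 2 ^ n := by
      refine le_trans ?_ hn
      gcongr
      exact grid_mono hμ j.le_succ
    obtain ⟨i, hij, hi, hfar⟩ := ih hn'
    by_cases hc : μ / 32 < ‖emb A (proxPath A b μ n y i - y)‖
    · exact ⟨i, hij.trans j.le_succ, hi, fun _ => hc⟩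
    · obtain rfl : i = j := le_antisymm hij (not_lt.1 fun h => hc (hfar h))
      refine ⟨i + 1, le_rfl, ?_, by simp⟩
      rw [grid_succ, proxPath, grid_succ]
      refine isApproxProx_iterate hA hμ (grid_pos hμ i).le hi (not_lt.1 hc) ?_
      rwa [← grid_succ]

end Path

/-! ### The accelerated step -/

section Potential

variable {E : Type} [NormedAddCommGroup E] [InnerProductSpace ℝ E]

/-- The decrease of the potential `a (F x - F xstar) + ‖v - xstar‖² / 2` in one accelerated
proximal step from the extrapolated point `y` to `t`. The step size `lam` of the proximal step may be
smaller than the step size `lam'` that determines `y`; the step is then damped by `γ = lam / lam'`. -/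
lemma accel_step {a α lam lam' γ ft fx fs : ℝ} {x v y t s g : E} (ha : 0 ≤ a) (hα : 0 ≤ α)
    (hlam : 0 < lam) (hlam' : 0 < lam') (hγ : γ = lam / lam') (hα2 : α ^ 2 = lam' * (a + α))
    (hy : (a + α) • y = a • x + α • v) (hs : ft + inner ℝ g (s - t) ≤ fs)
    (hx : ft + inner ℝ g (x - t) ≤ fx) (hprox : ‖lam • g + (t - y)‖ ≤ ‖t - y‖ / 4) :
    γ * ((a + α) * (ft - fs) - a * (fx - fs)) + ‖v - (γ * α) • g - s‖ ^ 2 / 2 ≤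
      ‖v - s‖ ^ 2 / 2 - 1 / 4 * (γ * (a + α) / lam * ‖t - y‖ ^ 2) := by
  have hγ0 : 0 ≤ γ := by rw [hγ]; positivity
  have e1 : a * inner ℝ g (x - t) + α * inner ℝ g (s - t) =
      -((a + α) * inner ℝ g (t - y)) - α * inner ℝ g (v - s) := by
    rw [← inner_smul_right, ← inner_smul_right, ← inner_smul_right, ← inner_smul_right,
      ← inner_add_right, ← inner_neg_right, ← inner_sub_right]
    congr 1
    rw [smul_sub (a + α), hy]
    simp only [smul_sub, add_smul]; abel
  have e2 : ‖v - (γ * α) • g - s‖ ^ 2 =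
      ‖v - s‖ ^ 2 - 2 * (γ * α) * inner ℝ g (v - s) + (γ * α) ^ 2 * ‖g‖ ^ 2 := by
    rw [sub_right_comm, norm_sub_sq_real, inner_smul_right, norm_smul, mul_pow, Real.norm_eq_abs,
      sq_abs, real_inner_comm]
    ring
  have e3 : ‖lam • g + (t - y)‖ ^ 2 =
      lam ^ 2 * ‖g‖ ^ 2 + 2 * lam * inner ℝ g (t - y) + ‖t - y‖ ^ 2 := by
    rw [norm_add_sq_real, inner_smul_left, norm_smul, mul_pow, Real.norm_eq_abs, sq_abs]
    simp; ring
  have e4 : ‖lam • g + (t - y)‖ ^ 2 ≤ ‖t - y‖ ^ 2 / 16 := by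
    have := pow_le_pow_left₀ (norm_nonneg _) hprox 2
    linarith
  have e5 : (γ * α) ^ 2 = γ * (a + α) * lam := by
    rw [mul_pow, hα2, hγ]; field_simp
  have e6 : lam * ‖g‖ ^ 2 / 2 + inner ℝ g (t - y) ≤ -(15 / 32) * (‖t - y‖ ^ 2 / lam) := by
    rw [mul_div_assoc', le_div_iff₀ hlam]; nlinarith
  have e7 := mul_le_mul_of_nonneg_left e6 (mul_nonneg hγ0 (add_nonneg ha hα))
  have e8 : γ * ((a + α) * (ft - fs) - a * (fx - fs)) ≤
      γ * ((a + α) * inner ℝ g (t - y) + α * inner ℝ g (v - s)) := by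
    refine mul_le_mul_of_nonneg_left ?_ hγ0
    nlinarith [mul_le_mul_of_nonneg_left hs hα, mul_le_mul_of_nonneg_left hx ha]
  have e9 : 0 ≤ γ * (a + α) * (‖t - y‖ ^ 2 / lam) := by positivity
  have e10 : γ * (a + α) / lam * ‖t - y‖ ^ 2 = γ * (a + α) * (‖t - y‖ ^ 2 / lam) := by ring
  rw [e2, e5, e10]
  nlinarith

lemma norm_sq_average_le {ι : Type} (s : Finset ι) {θ : ℝ} (hθ : 0 ≤ θ) (hs : θ * s.card = 1)
    (u : ι → E) : ‖θ • ∑ c ∈ s, u c‖ ^ 2 ≤ θ * ∑ c ∈ s, ‖u c‖ ^ 2 := by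
  have hc : ConvexOn ℝ Set.univ (fun u : E => ‖u‖ ^ 2) :=
    convexOn_univ_norm.pow (fun _ _ => norm_nonneg _) 2
  have := hc.map_sum_le (t := s) (w := fun _ => θ) (p := u) (fun _ _ => hθ)
    (by rw [Finset.sum_const, nsmul_eq_mul, mul_comm]; exact hs) (fun _ _ => Set.mem_univ _)
  simpa [Finset.smul_sum, Finset.mul_sum] using this

/-- The potential is convex in `(a, a x, v)`, so the mean of several accelerated steps decreases it
by the mean of their decreases. Here `F x' + ⟪g', · - x'⟫` minorises `F`. -/
lemma accel_average {ι : Type} (s : Finset ι) {θ a a' fx fx' fs : ℝ} {x x' v xs g' : E}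
    {γ α ft D : ι → ℝ} {t g : ι → E} (hθ : 0 ≤ θ) (hs : θ * s.card = 1) (ha : 0 ≤ a)
    (hα : ∀ c ∈ s, 0 ≤ α c) (hγ : ∀ c ∈ s, 0 ≤ γ c) (hγ1 : ∀ c ∈ s, γ c ≤ 1)
    (ha' : a' = a + θ * ∑ c ∈ s, γ c * α c)
    (hx' : a' • x' = a • x + θ • ∑ c ∈ s, γ c • ((a + α c) • t c - a • x))
    (hx : fx' + inner ℝ g' (x - x') ≤ fx) (ht : ∀ c ∈ s, fx' + inner ℝ g' (t c - x') ≤ ft c)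
    (hstep : ∀ c ∈ s, γ c * ((a + α c) * (ft c - fs) - a * (fx - fs))
      + ‖v - (γ c * α c) • g c - xs‖ ^ 2 / 2 ≤ ‖v - xs‖ ^ 2 / 2 - D c) :
    a' * (fx' - fs) + ‖v - θ • ∑ c ∈ s, (γ c * α c) • g c - xs‖ ^ 2 / 2 ≤
      a * (fx - fs) + ‖v - xs‖ ^ 2 / 2 - θ * ∑ c ∈ s, D c := by
  have h0 : ∀ {M : Type} [AddCommGroup M] [Module ℝ M] (u : M), θ • ∑ _c ∈ s, u = u := by
    intro M _ _ u
    rw [Finset.sum_const, ← Nat.cast_smul_eq_nsmul ℝ, smul_smul, hs, one_smul]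
  have hn : ‖v - θ • ∑ c ∈ s, (γ c * α c) • g c - xs‖ ^ 2 ≤
      θ * ∑ c ∈ s, ‖v - (γ c * α c) • g c - xs‖ ^ 2 := by
    refine le_trans (le_of_eq ?_) (norm_sq_average_le s hθ hs _)
    simp only [Finset.sum_sub_distrib, smul_sub, h0]
  -- Jensen's inequality for `F`, through the minorant at `x'`.
  have hF : a' * fx' ≤ a * fx + θ * ∑ c ∈ s, γ c * ((a + α c) * ft c - a * fx) := by
    have hterm : ∀ c ∈ s, a * (1 - γ c) * (fx' + inner ℝ g' (x - x')) +
        γ c * (a + α c) * (fx' + inner ℝ g' (t c - x')) ≤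
        a * fx + γ c * ((a + α c) * ft c - a * fx) := fun c hc => by
      have h1 := mul_le_mul_of_nonneg_left hx (mul_nonneg ha (sub_nonneg.2 (hγ1 c hc)))
      have h2 := mul_le_mul_of_nonneg_left (ht c hc)
        (mul_nonneg (hγ c hc) (add_nonneg ha (hα c hc)))
      linarith
    have hsum := mul_le_mul_of_nonneg_left (Finset.sum_le_sum hterm) hθ
    have hr : θ * ∑ c ∈ s, (a * fx + γ c * ((a + α c) * ft c - a * fx)) =
        a * fx + θ * ∑ c ∈ s, γ c * ((a + α c) * ft c - a * fx) := by
      rw [Finset.sum_add_distrib, mul_add]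
      congr 1
      exact h0 (a * fx)
    have hl : θ * ∑ c ∈ s, (a * (1 - γ c) * (fx' + inner ℝ g' (x - x')) +
        γ c * (a + α c) * (fx' + inner ℝ g' (t c - x'))) = a' * fx' := by
      have hv : θ • ∑ c ∈ s, ((a * (1 - γ c)) • (x - x') + (γ c * (a + α c)) • (t c - x')) =
          (0 : E) := by
        have e : ∀ c, (a * (1 - γ c)) • (x - x') + (γ c * (a + α c)) • (t c - x') =
            a • x + γ c • ((a + α c) • t c - a • x) - (a • x' + (γ c * α c) • x') := fun c => by
          module
        rw [Finset.sum_congr rfl fun c _ => e c, Finset.sum_sub_distrib, Finset.sum_add_distrib,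
          Finset.sum_add_distrib, smul_sub, smul_add, smul_add, h0, h0, ← hx', ← Finset.sum_smul,
          ha', add_smul, mul_smul]
        abel
      have e : ∀ c, a * (1 - γ c) * (fx' + inner ℝ g' (x - x')) +
          γ c * (a + α c) * (fx' + inner ℝ g' (t c - x')) = a * fx' + fx' * (γ c * α c) +
          inner ℝ g' ((a * (1 - γ c)) • (x - x') + (γ c * (a + α c)) • (t c - x')) := fun c => by
        rw [inner_add_right, inner_smul_right, inner_smul_right]; ring
      have h1 : θ * ∑ _c ∈ s, a * fx' = a * fx' := h0 (a * fx')
      rw [Finset.sum_congr rfl fun c _ => e c, Finset.sum_add_distrib, Finset.sum_add_distrib,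
        mul_add, mul_add, h1, ← Finset.mul_sum, ← inner_sum, ← inner_smul_right, hv, inner_zero_right, ha']
      ring
    linarith
  have hsum := mul_le_mul_of_nonneg_left (Finset.sum_le_sum hstep) hθ
  have e1 : θ * ∑ c ∈ s, (γ c * ((a + α c) * (ft c - fs) - a * (fx - fs))
      + ‖v - (γ c * α c) • g c - xs‖ ^ 2 / 2) =
      θ * ∑ c ∈ s, γ c * ((a + α c) * ft c - a * fx) - θ * (∑ c ∈ s, γ c * α c) * fs +
      (θ * ∑ c ∈ s, ‖v - (γ c * α c) • g c - xs‖ ^ 2) / 2 := by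
    have e : ∀ c, γ c * ((a + α c) * (ft c - fs) - a * (fx - fs)) =
        γ c * ((a + α c) * ft c - a * fx) - γ c * α c * fs := fun c => by ring
    simp only [e, Finset.sum_add_distrib, Finset.sum_sub_distrib, ← Finset.sum_mul,
      ← Finset.sum_div]
    ring
  have e2 : θ * ∑ c ∈ s, (‖v - xs‖ ^ 2 / 2 - D c) = ‖v - xs‖ ^ 2 / 2 - θ * ∑ c ∈ s, D c := by
    rw [Finset.sum_sub_distrib, mul_sub]
    congr 1
    exact h0 (‖v - xs‖ ^ 2 / 2)
  rw [e1, e2] at hsum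
  rw [mul_sub]
  have : a' * fs = a * fs + θ * (∑ c ∈ s, γ c * α c) * fs := by rw [ha']; ring
  linarith

end Potential

section Step

/-- The positive root `α` of `α² = lam (a + α)`. -/
def massInc (lam a : ℝ) : ℝ := (lam + √(lam ^ 2 + 4 * lam * a)) / 2

/-- The index pairs `(j, i)` of the step sizes `grid μ j` and `grid μ i` that determine the
extrapolated point and the proximal step from it. -/
def pairs (J : ℕ) : Finset (ℕ × ℕ) := Finset.range (J + 1) ×ˢ Finset.range (J + 1)

/-- The weight of each pair in the mean over all pairs. -/
def pairWeight (J : ℕ) : ℝ := 1 / ((J : ℝ) + 1) ^ 2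

lemma massInc_sq {lam a : ℝ} (hl : 0 ≤ lam) (ha : 0 ≤ a) :
    massInc lam a ^ 2 = lam * (a + massInc lam a) := by
  have h := Real.sq_sqrt (by positivity : 0 ≤ lam ^ 2 + 4 * lam * a)
  rw [massInc]; linear_combination h / 4

lemma le_massInc {lam a : ℝ} (hl : 0 ≤ lam) (ha : 0 ≤ a) : lam ≤ massInc lam a := by
  have h : lam ≤ √(lam ^ 2 + 4 * lam * a) := Real.le_sqrt_of_sq_le (by nlinarith [mul_nonneg hl ha])
  rw [massInc]; linarith

lemma sqrt_le_massInc {lam a : ℝ} (hl : 0 ≤ lam) (ha : 0 ≤ a) : √(lam * a) ≤ massInc lam a := by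
  have h0 := hl.trans (le_massInc hl ha)
  rw [Real.sqrt_le_left h0, massInc_sq hl ha]
  nlinarith [mul_nonneg hl h0]

lemma pairWeight_pos (J : ℕ) : 0 < pairWeight J := by unfold pairWeight; positivity

lemma pairWeight_mul_card (J : ℕ) : pairWeight J * (pairs J).card = 1 := by
  simp only [pairWeight, pairs, Finset.card_product, Finset.card_range]
  push_cast
  field_simp

variable {m d : ℕ} (A : Matrix (Fin m) (Fin d) ℝ) (b : Fin m → ℝ) (μ : ℝ) (J n : ℕ)

/-- The extrapolated point for the mass increment `α`. -/
def center (a α : ℝ) (x v : Fin d → ℝ) : Fin d → ℝ := (a / (a + α)) • x + (α / (a + α)) • v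

/-- The candidate for the proximal step with step size `grid μ c.2` from the extrapolated point that
belongs to `grid μ c.1`. -/
def candidate (a : ℝ) (x v : Fin d → ℝ) (c : ℕ × ℕ) : Fin d → ℝ :=
  proxPath A b μ n (center a (massInc (grid μ c.1) a) x v) c.2

open Classical in
/-- The damping factor of the step for the pair `c`; it is `0`, so that no step is made, if the
candidate is not an approximate proximal point or if the factor would exceed `1`. -/
def damping (a : ℝ) (x v : Fin d → ℝ) (c : ℕ × ℕ) : ℝ :=
  if c.2 ≤ c.1 ∧ IsApproxProx A b μ (grid μ c.2) (center a (massInc (grid μ c.1) a) x v)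
    (candidate A b μ n a x v c) then grid μ c.2 / grid μ c.1 else 0

/-- The mass after the mean of the accelerated steps for all pairs. -/
def nextMass (a : ℝ) (x v : Fin d → ℝ) : ℝ :=
  a + pairWeight J * ∑ c ∈ pairs J, damping A b μ n a x v c * massInc (grid μ c.1) a

/-- The primal point after the mean of the accelerated steps for all pairs. -/
def nextPoint (a : ℝ) (x v : Fin d → ℝ) : Fin d → ℝ :=
  (1 / nextMass A b μ J n a x v) • (a • x + pairWeight J • ∑ c ∈ pairs J, damping A b μ n a x v c •
    ((a + massInc (grid μ c.1) a) • candidate A b μ n a x v c - a • x))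

/-- The dual point after the mean of the accelerated steps for all pairs. -/
def nextDual (a : ℝ) (x v : Fin d → ℝ) : Fin d → ℝ :=
  v - pairWeight J • ∑ c ∈ pairs J, (damping A b μ n a x v c * massInc (grid μ c.1) a) •
    rieszGrad A b μ (candidate A b μ n a x v c)

variable {A b μ J n}

lemma damping_nonneg (hμ : 0 < μ) (a : ℝ) (x v : Fin d → ℝ) (c : ℕ × ℕ) :
    0 ≤ damping A b μ n a x v c := by
  unfold damping
  split_ifs
  · exact div_nonneg (grid_pos hμ _).le (grid_pos hμ _).le
  · exact le_rfl

lemma damping_le_one (hμ : 0 < μ) (a : ℝ) (x v : Fin d → ℝ) (c : ℕ × ℕ) :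
    damping A b μ n a x v c ≤ 1 := by
  unfold damping
  split_ifs with h
  · exact div_le_one_of_le₀ (grid_mono hμ h.1) (grid_pos hμ _).le
  · exact zero_le_one

lemma le_nextMass (hμ : 0 < μ) {a : ℝ} (ha : 0 ≤ a) (x v : Fin d → ℝ) {c : ℕ × ℕ}
    (hc : c ∈ pairs J) :
    a + pairWeight J * (damping A b μ n a x v c * massInc (grid μ c.1) a) ≤
      nextMass A b μ J n a x v := by
  refine add_le_add le_rfl (mul_le_mul_of_nonneg_left ?_ (pairWeight_pos J).le)
  exact Finset.single_le_sum (f := fun c => damping A b μ n a x v c * massInc (grid μ c.1) a)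
    (fun c _ => mul_nonneg (damping_nonneg hμ a x v c)
      ((grid_pos hμ _).le.trans (le_massInc (grid_pos hμ _).le ha))) hc

lemma damping_diag (hμ : 0 < μ) {a : ℝ} {x v : Fin d → ℝ} {j : ℕ}
    (h : IsApproxProx A b μ (grid μ j) (center a (massInc (grid μ j) a) x v)
      (candidate A b μ n a x v (j, j))) : damping A b μ n a x v (j, j) = 1 := by
  rw [damping, if_pos ⟨le_rfl, h⟩]
  exact div_self (grid_pos hμ j).ne'

variable [NeZero m]

lemma nextMass_ge (hA : (Aᵀ * A).PosDef) (hμ : 0 < μ) {a : ℝ} (ha : 0 ≤ a) (x v : Fin d → ℝ) :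
    a + pairWeight J * grid μ 0 ≤ nextMass A b μ J n a x v := by
  have hmem : ((0, 0) : ℕ × ℕ) ∈ pairs J := by simp [pairs]
  refine le_trans ?_ (le_nextMass hμ ha x v hmem)
  rw [damping_diag hμ (isApproxProx_proxPath_zero hA hμ n _), one_mul]
  have := pairWeight_pos J
  gcongr
  exact le_massInc (grid_pos hμ 0).le ha

/-- One accelerated step decreases the potential `a (f_μ x - f_μ xs) + ‖v - xs‖² / 2` by some
`D ≥ 0`. Either the mass jumps to the order of the largest step size, or for some step size `l`
both the mass grows by the order of `√(l a)` and `D` is at least of the order `a r² / l`, where `r` is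
the radius on which the softmax is well approximated by its quadratic model. The step size `l` is
where the path of proximal points starts to leave the ball of radius `r` around the extrapolated
point. -/
lemma accel_progress (hA : (Aᵀ * A).PosDef) (hμ : 0 < μ) {a : ℝ} (ha : 0 ≤ a)
    (x v xs : Fin d → ℝ) (hn : 32 * √(1 + grid μ J / μ) ≤ 2 ^ n) :
    ∃ D : ℝ, 0 ≤ D ∧
      nextMass A b μ J n a x v *
          (smoothObjective A b μ (nextPoint A b μ J n a x v) - smoothObjective A b μ xs)
        + ‖emb A (nextDual A b μ J n a x v - xs)‖ ^ 2 / 2 ≤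
      a * (smoothObjective A b μ x - smoothObjective A b μ xs) + ‖emb A (v - xs)‖ ^ 2 / 2 - D ∧
      (pairWeight J * grid μ J ≤ nextMass A b μ J n a x v ∨
        ∃ l, 0 < l ∧ a + pairWeight J * √(l * a) ≤ nextMass A b μ J n a x v ∧
          pairWeight J * (a / l * (μ / 32) ^ 2) / 8 ≤ D) := by
  set θ := pairWeight J with hθ
  have hθ0 : 0 < θ := pairWeight_pos J
  set γ := damping A b μ n a x v with hγ
  set α : ℕ × ℕ → ℝ := fun c => massInc (grid μ c.1) a with hα
  set y : ℕ × ℕ → Fin d → ℝ := fun c => center a (massInc (grid μ c.1) a) x v with hy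
  set t := candidate A b μ n a x v with ht
  have hα0 : ∀ c, 0 < α c := fun c =>
    (grid_pos hμ _).trans_le (le_massInc (grid_pos hμ _).le ha)
  set D : ℕ × ℕ → ℝ := fun c =>
    1 / 4 * (γ c * (a + α c) / grid μ c.2 * ‖emb A (t c - y c)‖ ^ 2) with hD
  have hD0 : ∀ c, 0 ≤ D c := fun c => by
    have := damping_nonneg (A := A) (b := b) (n := n) hμ a x v c
    have h2 := (hα0 c).le
    have h3 := grid_pos hμ c.2
    simp only [hD, hγ]
    positivity
  have hmass := nextMass_ge (J := J) (n := n) (b := b) hA hμ ha x v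
  have hmpos : 0 < nextMass A b μ J n a x v :=
    lt_of_lt_of_le (by have := mul_pos hθ0 (grid_pos hμ 0); linarith) hmass
  refine ⟨θ * ∑ c ∈ pairs J, D c, mul_nonneg hθ0.le (Finset.sum_nonneg fun c _ => hD0 c), ?_, ?_⟩
  · have key := accel_average (pairs J) (θ := θ) (a := a) (a' := nextMass A b μ J n a x v)
      (fx := smoothObjective A b μ x) (fx' := smoothObjective A b μ (nextPoint A b μ J n a x v))
      (fs := smoothObjective A b μ xs) (x := emb A x) (x' := emb A (nextPoint A b μ J n a x v))
      (v := emb A v) (xs := emb A xs)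
      (g' := emb A (rieszGrad A b μ (nextPoint A b μ J n a x v)))
      (γ := γ) (α := α) (ft := fun c => smoothObjective A b μ (t c)) (D := D)
      (t := fun c => emb A (t c)) (g := fun c => emb A (rieszGrad A b μ (t c)))
      hθ0.le (pairWeight_mul_card J) ha (fun c _ => (hα0 c).le)
      (fun c _ => damping_nonneg hμ a x v c) (fun c _ => damping_le_one hμ a x v c) rfl ?_ ?_ ?_ ?_
    · have e : emb A (nextDual A b μ J n a x v - xs) =
          emb A v - θ • ∑ c ∈ pairs J, (γ c * α c) • emb A (rieszGrad A b μ (t c)) - emb A xs := by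
        simp only [nextDual, map_sub, map_smul, map_sum]; rfl
      rw [e, map_sub]
      exact key
    · rw [← map_smul, nextPoint, smul_smul, mul_one_div_cancel hmpos.ne', one_smul]
      simp only [map_add, map_sub, map_smul, map_sum]; rfl
    · rw [← map_sub, inner_rieszGrad hA]
      exact smoothObjective_add_slope_le hμ _ _
    · intro c _
      rw [← map_sub, inner_rieszGrad hA]
      exact smoothObjective_add_slope_le hμ _ _
    · intro c _
      by_cases hc : c.2 ≤ c.1 ∧ IsApproxProx A b μ (grid μ c.2) (y c) (t c)
      · have hγc : γ c = grid μ c.2 / grid μ c.1 := if_pos hc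
        have h := accel_step (γ := γ c) (x := emb A x) (v := emb A v) (y := emb A (y c))
          (t := emb A (t c)) (s := emb A xs) (g := emb A (rieszGrad A b μ (t c)))
          (ft := smoothObjective A b μ (t c)) (fx := smoothObjective A b μ x)
          (fs := smoothObjective A b μ xs) ha (hα0 c).le
          (grid_pos hμ c.2) (grid_pos hμ c.1) hγc (massInc_sq (grid_pos hμ c.1).le ha) ?_ ?_ ?_ ?_
        · simpa only [← map_sub, hD] using h
        · have hne : a + α c ≠ 0 := (add_pos_of_nonneg_of_pos ha (hα0 c)).ne'
          simp only [← map_smul, ← map_add]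
          congr 1
          simp only [hy, center, smul_add, smul_smul]
          rw [mul_div_cancel₀ _ hne, mul_div_cancel₀ _ hne]
        · rw [← map_sub, inner_rieszGrad hA]
          exact smoothObjective_add_slope_le hμ _ _
        · rw [← map_sub, inner_rieszGrad hA]
          exact smoothObjective_add_slope_le hμ _ _
        · have := hc.2
          rw [IsApproxProx, proxErr] at this
          simpa only [map_sub, map_add, map_smul] using this
      · have hγc : γ c = 0 := if_neg hc
        simp [hD, hγc]
  · by_cases hall : ∀ j ≤ J, IsApproxProx A b μ (grid μ j) (y (j, j)) (t (j, j))
    · left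
      have hmem : ((J, J) : ℕ × ℕ) ∈ pairs J := by simp [pairs]
      refine le_trans ?_ (le_nextMass hμ ha x v hmem)
      rw [damping_diag hμ (hall J le_rfl), one_mul]
      have := mul_le_mul_of_nonneg_left (le_massInc (grid_pos hμ J).le ha) hθ0.le
      linarith
    · right
      push Not at hall
      classical
      obtain ⟨k, ⟨hkJ, hk⟩, hmin⟩ : ∃ k, (k ≤ J ∧ ¬ IsApproxProx A b μ (grid μ k) (y (k, k))
          (t (k, k))) ∧ ∀ j < k, ¬ (j ≤ J ∧ ¬ IsApproxProx A b μ (grid μ j) (y (j, j)) (t (j, j))) :=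
        ⟨Nat.find hall, Nat.find_spec hall, fun j hj => Nat.find_min hall hj⟩
      obtain ⟨j, rfl⟩ : ∃ j, k = j + 1 := by
        refine Nat.exists_eq_succ_of_ne_zero fun h0 => hk ?_
        subst h0
        exact isApproxProx_proxPath_zero hA hμ n _
      have hj : IsApproxProx A b μ (grid μ j) (y (j, j)) (t (j, j)) := by
        by_contra h
        exact hmin j j.lt_succ_self ⟨by omega, h⟩
      refine ⟨grid μ j, grid_pos hμ j, ?_, ?_⟩
      · have hmem : ((j, j) : ℕ × ℕ) ∈ pairs J := by simp [pairs]; omega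
        refine le_trans ?_ (le_nextMass hμ ha x v hmem)
        rw [damping_diag hμ hj, one_mul]
        have := mul_le_mul_of_nonneg_left (sqrt_le_massInc (grid_pos hμ j).le ha) hθ0.le
        linarith
      · have hn' : 32 * √(1 + grid μ (j + 1) / μ) ≤ 2 ^ n := by
          refine le_trans ?_ hn
          gcongr
          exact grid_mono hμ hkJ
        obtain ⟨i, hi, hprox, hfar⟩ := exists_isApproxProx (b := b) hA hμ
          (y (j + 1, j + 1)) (j + 1) hn'
        have hij : i < j + 1 := by
          refine lt_of_le_of_ne hi fun h => hk ?_
          subst h; exact hprox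
        have hmem : ((j + 1, i) : ℕ × ℕ) ∈ pairs J := by simp [pairs]; omega
        have hγc : γ (j + 1, i) = grid μ i / grid μ (j + 1) := if_pos ⟨hi, hprox⟩
        have h1 : D (j + 1, i) ≤ ∑ c ∈ pairs J, D c :=
          Finset.single_le_sum (fun c _ => hD0 c) hmem
        have hfar' : (μ / 32) ^ 2 ≤ ‖emb A (t (j + 1, i) - y (j + 1, i))‖ ^ 2 :=
          pow_le_pow_left₀ (by positivity) (hfar hij).le 2
        have hgi := grid_pos hμ i
        have hgj := grid_pos hμ j
        have h2 : a / grid μ j * (μ / 32) ^ 2 / 8 ≤ D (j + 1, i) := by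
          have e : D (j + 1, i) = 1 / 4 * ((a + α (j + 1, i)) / (2 * grid μ j) *
              ‖emb A (t (j + 1, i) - y (j + 1, i))‖ ^ 2) := by
            simp only [hD, hγc]
            rw [grid_succ]; field_simp
          rw [e]
          have h3 : a / (2 * grid μ j) ≤ (a + α (j + 1, i)) / (2 * grid μ j) := by
            gcongr; linarith [hα0 (j + 1, i)]
          have h4 := mul_le_mul h3 hfar' (by positivity) (by have := hα0 (j + 1, i); positivity)
          calc a / grid μ j * (μ / 32) ^ 2 / 8 = 1 / 4 * (a / (2 * grid μ j) * (μ / 32) ^ 2) := by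
                field_simp; ring
            _ ≤ _ := by linarith
        have := mul_le_mul_of_nonneg_left (h2.trans h1) hθ0.le
        linarith

end Step

/-! ### The programs -/

section Programs

/-- Sequential composition of programs. -/
def Prog.bind {α β : Type} : Prog α → (α → Prog β) → Prog β
  | .done a, f => f a
  | .op c p, f => .op c (p.bind f)
  | .query q k, f => .query q fun r => (k r).bind f

/-- Started with the registers `s`, the program `p` executes at most `c` instructions, and its result
and the final registers satisfy `Q`. -/
def Spec {m d : ℕ} (A : Matrix (Fin m) (Fin d) ℝ) (b : Fin m → ℝ) {α : Type} (p : Prog α)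
    (s : Regs m d) (c : ℕ) (Q : α → Regs m d → Prop) : Prop :=
  Q (p.run A b s).1 (p.run A b s).2 ∧ p.cost A b s ≤ c

/-- The contents of the registers that matter between the parts of the method: the vector `b`, the
primal and dual points `x` and `v`, the accumulators `z` and `w` for their successors, the
extrapolated point `y` and the current point `t` on its path of proximal points. -/
structure Mem {m d : ℕ} (b : Fin m → ℝ) (x v z w y t : Fin d → ℝ) (s : Regs m d) : Prop where
  hb : s.u 0 = b
  hx : s.x 0 = x
  hv : s.x 1 = v
  hz : s.x 2 = z
  hw : s.x 3 = w
  hy : s.x 4 = y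
  ht : s.x 5 = t

/-- One Newton step for the proximal objective with step size `lam`. The register `u 2` receives the
unnormalised softmax weights and then the diagonal of `D`; `x 6` receives the gradient of `f_μ`,
`x 7` the gradient of the proximal objective; then both linear systems are solved. -/
def newtonProg (μ lam : ℝ) : Prog Unit :=
  .op (.gradient μ 5 6) <| .op (.mulA 5 1) <| .op (.linCombU (1 / μ) 1 (-(1 / μ)) 0 1) <|
  .op (.expU 1 2) <| .op (.linCombU (-1) 1 0 1 1) <| .op (.expU 1 3) <|
  .op (.linCombU 1 2 1 3 2) <| .op (.onesU 3) <| .query (.innerU 2 3) fun Z =>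
  .op (.linCombU (lam / (μ * Z)) 2 1 3 2) <| .op (.linComb 1 5 (-1) 4 7) <| .op (.mulA 7 1) <|
  .op (.mulAT 1 7) <| .op (.linComb lam 6 1 7 7) <| .op (.solve 2 7 7) <| .op (.solve 2 6 8) <|
  .query (.inner 6 7) fun r => .query (.inner 6 8) fun r' =>
  .op (.linComb 1 7 (lam / μ * r / (1 - lam / μ * r')) 8 7) <| .op (.linComb 1 5 (-1) 7 5) <|
  .done ()

/-- The first point of the path of proximal points. -/
def startProg (μ : ℝ) : Prog Unit :=
  .op (.gradient μ 4 6) <| .op (.onesU 1) <| .op (.solve 1 6 6) <|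
  .op (.linComb 1 4 (-(μ / 16)) 6 5) <| .done ()

open Classical in
/-- Test the current point on the path and add its contribution to the accumulators. -/
def collectProg (μ θ a α lam lam' : ℝ) (le : Prop) (acc : ℝ) : Prog ℝ :=
  .op (.gradient μ 5 6) <| .op (.onesU 1) <| .op (.solve 1 6 6) <| .op (.linComb 1 5 (-1) 4 7) <|
  .op (.mulA 7 1) <| .query (.innerU 1 1) fun disp => .op (.linComb lam 6 1 7 7) <|
  .op (.mulA 7 1) <| .query (.innerU 1 1) fun err =>
  let γ := if le ∧ err ≤ disp / 16 then lam / lam' else 0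
  .op (.linComb 1 2 (θ * (γ * (a + α))) 5 2) <| .op (.linComb 1 2 (-(θ * (γ * a))) 0 2) <|
  .op (.linComb 1 3 (-(θ * (γ * α))) 6 3) <| .done (acc + θ * (γ * α))

/-- The `n`-fold repetition of a program. -/
def repeatProg (p : Prog Unit) : ℕ → Prog Unit
  | 0 => .done ()
  | n + 1 => (repeatProg p n).bind fun _ => p

/-- Follow the path of proximal points of the extrapolated point for `grid μ j` up to its `k`-th
point, and accumulate the contributions of these points. -/
def pathProg (μ θ a : ℝ) (n j : ℕ) (acc : ℝ) : ℕ → Prog ℝ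
  | 0 => (startProg μ).bind fun _ =>
      collectProg μ θ a (massInc (grid μ j) a) (grid μ 0) (grid μ j) (0 ≤ j) acc
  | k + 1 => (pathProg μ θ a n j acc k).bind fun acc' =>
      (repeatProg (newtonProg μ (grid μ (k + 1))) n).bind fun _ =>
        collectProg μ θ a (massInc (grid μ j) a) (grid μ (k + 1)) (grid μ j) (k + 1 ≤ j) acc'

/-- Treat the extrapolated points for the first `k` step sizes. -/
def scanProg (μ a : ℝ) (J n : ℕ) : ℕ → Prog ℝ
  | 0 => .done a
  | k + 1 => (scanProg μ a J n k).bind fun acc =>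
      .op (.linComb (a / (a + massInc (grid μ k) a)) 0
        (massInc (grid μ k) a / (a + massInc (grid μ k) a)) 1 4) <|
      pathProg μ (pairWeight J) a n k acc J

/-- One accelerated step. If the mass is still `0`, the dual point is initialised first. -/
def accelProg (μ : ℝ) (J n : ℕ) (a : ℝ) : Prog ℝ :=
  .op (.linComb (if a = 0 then 1 else 0) 0 (if a = 0 then 0 else 1) 1 1) <|
  .op (.linComb a 0 0 0 2) <| .op (.linComb 1 1 0 1 3) <|
  (scanProg μ a J n (J + 1)).bind fun a' =>
    .op (.linComb (1 / a') 2 0 2 0) <| .op (.linComb 1 3 0 3 1) <| .done a'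

/-- A sequence of `k` accelerated steps. -/
def stepsProg (μ : ℝ) (J n : ℕ) (a : ℝ) : ℕ → Prog ℝ
  | 0 => .done a
  | k + 1 => (stepsProg μ J n a k).bind (accelProg μ J n)

variable {m d : ℕ} {A : Matrix (Fin m) (Fin d) ℝ} {b : Fin m → ℝ} {μ : ℝ}

lemma Prog.run_bind {α β : Type} (p : Prog α) (f : α → Prog β) (s : Regs m d) :
    (p.bind f).run A b s = (f (p.run A b s).1).run A b (p.run A b s).2 := by
  induction p generalizing s with
  | done a => rfl
  | op c p ih => exact ih _
  | query q k ih => exact ih _ _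

lemma Prog.cost_bind {α β : Type} (p : Prog α) (f : α → Prog β) (s : Regs m d) :
    (p.bind f).cost A b s = p.cost A b s + (f (p.run A b s).1).cost A b (p.run A b s).2 := by
  induction p generalizing s with
  | done a => simp [Prog.bind, Prog.cost, Prog.run]
  | op c p ih => simp only [Prog.bind, Prog.cost, Prog.run, ih]; ring
  | query q k ih => simp only [Prog.bind, Prog.cost, Prog.run, ih]; ring

lemma Spec.bind {α β : Type} {p : Prog α} {f : α → Prog β} {s : Regs m d} {c c' : ℕ}
    {Q : α → Regs m d → Prop} {R : β → Regs m d → Prop} (hp : Spec A b p s c Q)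
    (hf : ∀ a s', Q a s' → Spec A b (f a) s' c' R) : Spec A b (p.bind f) s (c + c') R := by
  have h := hf _ _ hp.1
  refine ⟨?_, ?_⟩
  · rw [Prog.run_bind]; exact h.1
  · rw [Prog.cost_bind]; exact add_le_add hp.2 h.2

lemma Spec.op {α : Type} {p : Prog α} {o : VecOp} {s : Regs m d} {c : ℕ}
    {Q : α → Regs m d → Prop} (hp : Spec A b p (o.apply A b s) c Q) :
    Spec A b (.op o p) s (c + 1) Q :=
  ⟨hp.1, Nat.add_le_add_right hp.2 1⟩

lemma Spec.done {α : Type} {a : α} {s : Regs m d} {Q : α → Regs m d → Prop} (h : Q a s) :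
    Spec A b (.done a) s 0 Q := ⟨h, le_rfl⟩

lemma Spec.mono {α : Type} {p : Prog α} {s : Regs m d} {c c' : ℕ} {Q Q' : α → Regs m d → Prop}
    (hp : Spec A b p s c Q) (hc : c ≤ c') (hQ : ∀ a s', Q a s' → Q' a s') : Spec A b p s c' Q' :=
  ⟨hQ _ _ hp.1, hp.2.trans hc⟩

lemma sum_signed_exp (y : Fin m → ℝ) :
    ∑ k, Real.exp (pm y k / μ) =
      (fun i => Real.exp (y i / μ) + Real.exp (-(y i / μ))) ⬝ᵥ fun _ => 1 := by
  simp [pm, dotProduct, Finset.sum_add_distrib, neg_div]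

lemma isApproxProx_iff {lam : ℝ} {y t : Fin d → ℝ} :
    IsApproxProx A b μ lam y t ↔
      (A *ᵥ proxErr A b μ lam y t) ⬝ᵥ (A *ᵥ proxErr A b μ lam y t) ≤
        ((A *ᵥ (t - y)) ⬝ᵥ (A *ᵥ (t - y))) / 16 := by
  rw [IsApproxProx, ← norm_sq_emb, ← norm_sq_emb,
    ← pow_le_pow_iff_left₀ (norm_nonneg _) (by positivity) two_ne_zero, div_pow]
  norm_num

lemma Mem.center {x v z w y t : Fin d → ℝ} {s : Regs m d} (h : Mem b x v z w y t s) (a α : ℝ) :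
    Mem b x v z w (center a α x v) t
      (VecOp.apply A b s (.linComb (a / (a + α)) 0 (α / (a + α)) 1 4)) := by
  obtain ⟨hb, hx, hv, hz, hw, hy, ht⟩ := h
  refine ⟨hb, hx, hv, hz, hw, ?_, ht⟩
  simp [VecOp.apply, Regs.setX, hx, hv, LinfReg.center]

variable [NeZero m]

lemma spec_newtonProg (hμ : 0 < μ) (lam : ℝ) {x v z w y t : Fin d → ℝ} {s : Regs m d}
    (h : Mem b x v z w y t s) :
    Spec A b (newtonProg μ lam) s 20
      fun _ => Mem b x v z w y (newtonStep A b μ lam y t) := by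
  obtain ⟨hb, hx, hv, hz, hw, hy, ht⟩ := h
  set r := (1 / μ) • A *ᵥ t + (-(1 / μ)) • b with hr
  have hri : ∀ i, r i = (A *ᵥ t - b) i / μ := fun i => by
    simp only [hr, Pi.add_apply, Pi.smul_apply, Pi.sub_apply, smul_eq_mul]; ring
  set S : Fin m → ℝ := (1 : ℝ) • (fun l => Real.exp (r l)) +
    (1 : ℝ) • (fun l => Real.exp (((-1 : ℝ) • r + (0 : ℝ) • r) l)) with hS
  have hSi : S = fun i => Real.exp ((A *ᵥ t - b) i / μ) + Real.exp (-((A *ᵥ t - b) i / μ)) := by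
    funext i
    simp [hS, hri]
  have hD : (lam / (μ * (S ⬝ᵥ fun _ => 1))) • S + (1 : ℝ) • (fun _ => (1 : ℝ)) =
      diagWeights A b μ lam t := by
    have hpos := sum_exp_pos μ (pm (A *ᵥ t - b))
    rw [hSi, ← sum_signed_exp]
    funext i
    simp only [diagWeights, weights, gibbs, Pi.add_apply, Pi.smul_apply, smul_eq_mul]
    rw [show pm (A *ᵥ t - b) (Sum.inl i) = (A *ᵥ t - b) i from rfl,
      show pm (A *ᵥ t - b) (Sum.inr i) = -(A *ᵥ t - b) i from rfl, neg_div]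
    field_simp
  refine ⟨⟨?_, ?_, ?_, ?_, ?_, ?_, ?_⟩, by simp [newtonProg, Prog.cost]⟩
  case refine_7 =>
    simp only [newtonProg, Prog.run, VecOp.apply, ScalarQuery.value, Regs.setX, Regs.setU,
      Function.update_apply, Nat.reduceEqDiff, OfNat.ofNat_ne_one, OfNat.one_ne_ofNat, zero_ne_one,
      reduceIte,
      hb, hy, ht, grad_smoothObjective hμ]
    rw [← hr, ← hS, hD]
    simp only [newtonStep, one_smul, neg_one_smul, ← sub_eq_add_neg]
  all_goals
    simp [newtonProg, Prog.run, VecOp.apply, ScalarQuery.value, Regs.setX, Regs.setU, *]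

lemma spec_startProg (hμ : 0 < μ) (n : ℕ) {x v z w y t : Fin d → ℝ} {s : Regs m d}
    (h : Mem b x v z w y t s) :
    Spec A b (startProg μ) s 4 fun _ => Mem b x v z w y (proxPath A b μ n y 0) := by
  obtain ⟨hb, hx, hv, hz, hw, hy, ht⟩ := h
  refine ⟨⟨?_, ?_, ?_, ?_, ?_, ?_, ?_⟩, by simp [startProg, Prog.cost]⟩
  case refine_7 =>
    simp [startProg, Prog.run, VecOp.apply, Regs.setX, Regs.setU, hy, proxPath, rieszGrad,
      grad_smoothObjective hμ, sub_eq_add_neg]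
  all_goals
    simp [startProg, Prog.run, VecOp.apply, Regs.setX, Regs.setU, *]

lemma spec_collectProg (hμ : 0 < μ) {θ a α lam lam' acc γ : ℝ} {le : Prop}
    {x v z w y t : Fin d → ℝ} {s : Regs m d} (h : Mem b x v z w y t s)
    (h1 : le ∧ IsApproxProx A b μ lam y t → γ = lam / lam')
    (h0 : ¬(le ∧ IsApproxProx A b μ lam y t) → γ = 0) :
    Spec A b (collectProg μ θ a α lam lam' le acc) s 12 fun acc' s' =>
      acc' = acc + θ * (γ * α) ∧
      Mem b x v (z + θ • γ • ((a + α) • t - a • x))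
        (w - θ • (γ * α) • rieszGrad A b μ t) y t s' := by
  classical
  obtain ⟨hb, hx, hv, hz, hw, hy, ht⟩ := h
  have hγ : (if le ∧ (A *ᵥ proxErr A b μ lam y t) ⬝ᵥ (A *ᵥ proxErr A b μ lam y t) ≤
        ((A *ᵥ (t - y)) ⬝ᵥ (A *ᵥ (t - y))) / 16 then lam / lam' else 0) = γ := by
    by_cases hc : le ∧ IsApproxProx A b μ lam y t
    · rw [if_pos (by rwa [← isApproxProx_iff]), h1 hc]
    · rw [if_neg (by rwa [← isApproxProx_iff]), h0 hc]
  have e1 : (1 : ℝ) • t + (-1 : ℝ) • y = t - y := by rw [one_smul, neg_one_smul, sub_eq_add_neg]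
  have e2 : lam • rieszGrad A b μ t + (1 : ℝ) • (t - y) = proxErr A b μ lam y t := by
    rw [one_smul, proxErr]
  have hrun : (collectProg μ θ a α lam lam' le acc).run A b s =
      (acc + θ * (γ * α), ((collectProg μ θ a α lam lam' le acc).run A b s).2) ∧
      ((collectProg μ θ a α lam lam' le acc).run A b s).2.x 2 =
        (z + θ • γ • ((a + α) • t - a • x)) ∧
      ((collectProg μ θ a α lam lam' le acc).run A b s).2.x 3 =
        (w - θ • (γ * α) • rieszGrad A b μ t) := by
    simp only [collectProg, Prog.run, VecOp.apply, ScalarQuery.value, Regs.setX, Regs.setU,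
      Function.update_apply, Nat.reduceEqDiff, OfNat.zero_ne_ofNat, reduceIte,
      hx, hz, hw, hy, ht, grad_smoothObjective hμ]
    rw [← rieszGrad, e1, e2, hγ]
    refine ⟨rfl, ?_, ?_⟩ <;> module
  refine ⟨⟨by rw [hrun.1], ?_, ?_, ?_, hrun.2.1, hrun.2.2, ?_, ?_⟩,
    by simp [collectProg, Prog.cost]⟩
  all_goals
    simp [collectProg, Prog.run, VecOp.apply, ScalarQuery.value, Regs.setX, Regs.setU, *]

lemma spec_repeatProg (hμ : 0 < μ) (lam : ℝ) {x v z w y t : Fin d → ℝ} (n : ℕ) {s : Regs m d}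
    (h : Mem b x v z w y t s) :
    Spec A b (repeatProg (newtonProg μ lam) n) s (20 * n)
      fun _ => Mem b x v z w y ((newtonStep A b μ lam y)^[n] t) := by
  induction n with
  | zero => exact Spec.done h
  | succ n ih =>
    simp only [Function.iterate_succ_apply']
    exact ih.bind fun _ s' h' => spec_newtonProg hμ lam h'

lemma spec_pathProg (hμ : 0 < μ) {a acc : ℝ} {J n j : ℕ} {x v z w t : Fin d → ℝ} (k : ℕ)
    {s : Regs m d} (h : Mem b x v z w (center a (massInc (grid μ j) a) x v) t s) :
    Spec A b (pathProg μ (pairWeight J) a n j acc k) s ((k + 1) * (20 * n + 16)) fun acc' s' =>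
      acc' = acc + pairWeight J * ∑ i ∈ Finset.range (k + 1),
        damping A b μ n a x v (j, i) * massInc (grid μ j) a ∧
      Mem b x v
        (z + pairWeight J • ∑ i ∈ Finset.range (k + 1), damping A b μ n a x v (j, i) •
          ((a + massInc (grid μ j) a) • candidate A b μ n a x v (j, i) - a • x))
        (w - pairWeight J • ∑ i ∈ Finset.range (k + 1),
          (damping A b μ n a x v (j, i) * massInc (grid μ j) a) •
          rieszGrad A b μ (candidate A b μ n a x v (j, i)))
        (center a (massInc (grid μ j) a) x v) (candidate A b μ n a x v (j, k)) s' := by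
  induction k with
  | zero =>
    refine ((spec_startProg hμ n h).bind fun _ s' h' => spec_collectProg hμ
      (γ := damping A b μ n a x v (j, 0)) h' (fun hc => if_pos hc) (fun hc => if_neg hc)).mono
      (by omega) fun acc' s' h' => ?_
    simpa [candidate] using h'
  | succ k ih =>
    have hcost : (k + 1) * (20 * n + 16) + (20 * n + 12) ≤ (k + 1 + 1) * (20 * n + 16) := by
      nlinarith
    refine Spec.mono (ih.bind fun acc' s' h' => (spec_repeatProg hμ (grid μ (k + 1)) n h'.2).bind
      fun _ s'' h'' => (spec_collectProg hμ (γ := damping A b μ n a x v (j, k + 1)) h''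
        (fun hc => if_pos hc) (fun hc => if_neg hc)).mono le_rfl fun acc'' s3 h3 => ?_) hcost
      fun _ _ h => h
    rw [Finset.sum_range_succ _ (k + 1), Finset.sum_range_succ _ (k + 1),
      Finset.sum_range_succ _ (k + 1), mul_add, smul_add, smul_add, ← add_assoc, ← add_assoc,
      ← sub_sub, ← h'.1]
    exact h3

lemma spec_scanProg (hμ : 0 < μ) (a : ℝ) (J n : ℕ) {x v z w y t : Fin d → ℝ} (k : ℕ)
    {s : Regs m d} (h : Mem b x v z w y t s) :
    Spec A b (scanProg μ a J n k) s (k * (1 + (J + 1) * (20 * n + 16))) fun acc s' =>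
      acc = a + pairWeight J * ∑ c ∈ Finset.range k ×ˢ Finset.range (J + 1),
        damping A b μ n a x v c * massInc (grid μ c.1) a ∧
      ∃ y' t', Mem b x v
        (z + pairWeight J • ∑ c ∈ Finset.range k ×ˢ Finset.range (J + 1), damping A b μ n a x v c •
          ((a + massInc (grid μ c.1) a) • candidate A b μ n a x v c - a • x))
        (w - pairWeight J • ∑ c ∈ Finset.range k ×ˢ Finset.range (J + 1),
          (damping A b μ n a x v c * massInc (grid μ c.1) a) •
          rieszGrad A b μ (candidate A b μ n a x v c)) y' t' s' := by
  induction k with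
  | zero => exact (Spec.done ⟨by simp, y, t, by simpa using h⟩).mono (by simp) fun _ _ h => h
  | succ k ih =>
    refine (ih.bind (c' := 1 + (J + 1) * (20 * n + 16)) fun acc s' h' => ?_).mono (by ring_nf; rfl)
      fun acc s' h' => h'
    obtain ⟨hacc, y', t', h'⟩ := h'
    have h2 := h'.center a (massInc (grid μ k) a) (A := A)
    rw [add_comm 1]
    refine Spec.op ((spec_pathProg (J := J) (n := n) (acc := acc) hμ J h2).mono le_rfl
      fun acc' s'' h3 => ?_)
    obtain ⟨hacc', h3⟩ := h3
    refine ⟨?_, center a (massInc (grid μ k) a) x v, candidate A b μ n a x v (k, J), ?_⟩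
    · rw [hacc', hacc, Finset.sum_product, Finset.sum_product, Finset.sum_range_succ _ k, mul_add,
        ← add_assoc]
    · rw [Finset.sum_product, Finset.sum_product, Finset.sum_range_succ _ k,
        Finset.sum_range_succ _ k, smul_add, smul_add, ← add_assoc, ← sub_sub,
        ← Finset.sum_product _ _ fun c : ℕ × ℕ => damping A b μ n a x v c •
          ((a + massInc (grid μ c.1) a) • candidate A b μ n a x v c - a • x),
        ← Finset.sum_product _ _ fun c : ℕ × ℕ =>
          (damping A b μ n a x v c * massInc (grid μ c.1) a) •
          rieszGrad A b μ (candidate A b μ n a x v c)]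
      exact h3

lemma spec_accelProg (hμ : 0 < μ) (a : ℝ) (J n : ℕ) {x v : Fin d → ℝ}
    {s : Regs m d} (hb : s.u 0 = b) (hx : s.x 0 = x) (hv : a ≠ 0 → s.x 1 = v)
    (hv0 : a = 0 → v = x) :
    Spec A b (accelProg μ J n a) s (5 + (J + 1) * (1 + (J + 1) * (20 * n + 16))) fun a' s' =>
      a' = nextMass A b μ J n a x v ∧ s'.u 0 = b ∧ s'.x 0 = nextPoint A b μ J n a x v ∧
      s'.x 1 = nextDual A b μ J n a x v := by
  have h : Mem b x v (a • x) v (s.x 4) (s.x 5) (VecOp.apply A b (VecOp.apply A b (VecOp.apply A b s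
      (.linComb (if a = 0 then 1 else 0) 0 (if a = 0 then 0 else 1) 1 1))
      (.linComb a 0 0 0 2)) (.linComb 1 1 0 1 3)) := by
    by_cases ha : a = 0
    · have := hv0 ha
      constructor <;> simp [VecOp.apply, Regs.setX, ha, hb, hx, this]
    · have := hv ha
      constructor <;> simp [VecOp.apply, Regs.setX, ha, hb, hx, this]
  have hcost : 5 + (J + 1) * (1 + (J + 1) * (20 * n + 16)) =
      (J + 1) * (1 + (J + 1) * (20 * n + 16)) + (0 + 1 + 1) + 1 + 1 + 1 := by ring
  rw [hcost]
  refine Spec.op (Spec.op (Spec.op ((spec_scanProg hμ a J n (J + 1) h).bind fun a' s' h' => ?_)))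
  obtain ⟨ha', y', t', hb', hx', hv', hz', hw', hy', ht'⟩ := h'
  refine Spec.op (Spec.op (Spec.done ⟨ha', hb', ?_, ?_⟩))
  · have : a' = nextMass A b μ J n a x v := ha'
    simp only [VecOp.apply, Regs.setX, Function.update_apply, hz', this]
    simp [nextPoint, pairs]
  · simp [VecOp.apply, Regs.setX, hw', nextDual, pairs]

/-- The state after `k` accelerated steps from `x₀`: mass, primal point and dual point. -/
def track (A : Matrix (Fin m) (Fin d) ℝ) (b : Fin m → ℝ) (μ : ℝ) (J n : ℕ) (x₀ : Fin d → ℝ) :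
    ℕ → ℝ × (Fin d → ℝ) × (Fin d → ℝ)
  | 0 => (0, x₀, x₀)
  | k + 1 =>
    let s := track A b μ J n x₀ k
    (nextMass A b μ J n s.1 s.2.1 s.2.2, nextPoint A b μ J n s.1 s.2.1 s.2.2,
      nextDual A b μ J n s.1 s.2.1 s.2.2)

lemma track_mass_nonneg (hA : (Aᵀ * A).PosDef) (hμ : 0 < μ) (J n : ℕ) (x₀ : Fin d → ℝ) (k : ℕ) :
    0 ≤ (track A b μ J n x₀ k).1 := by
  induction k with
  | zero => exact le_rfl
  | succ k ih =>
    refine le_trans ?_ (nextMass_ge hA hμ ih _ _)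
    have := mul_pos (pairWeight_pos J) (grid_pos hμ 0)
    linarith

lemma track_mass_pos (hA : (Aᵀ * A).PosDef) (hμ : 0 < μ) (J n : ℕ) (x₀ : Fin d → ℝ) (k : ℕ) :
    0 < (track A b μ J n x₀ (k + 1)).1 := by
  refine lt_of_lt_of_le ?_ (nextMass_ge hA hμ (track_mass_nonneg hA hμ J n x₀ k) _ _)
  have := mul_pos (pairWeight_pos J) (grid_pos hμ 0)
  have := track_mass_nonneg (b := b) hA hμ J n x₀ k
  linarith

/-- The registers and the control state agree with the state of `track` after `k` steps. The dual
point is not yet stored before the first step. -/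
def Tracks (A : Matrix (Fin m) (Fin d) ℝ) (b : Fin m → ℝ) (μ : ℝ) (J n : ℕ) (x₀ : Fin d → ℝ)
    (k : ℕ) (a : ℝ) (s : Regs m d) : Prop :=
  a = (track A b μ J n x₀ k).1 ∧ s.u 0 = b ∧ s.x 0 = (track A b μ J n x₀ k).2.1 ∧
    (a ≠ 0 → s.x 1 = (track A b μ J n x₀ k).2.2)

lemma spec_stepsProg (hA : (Aᵀ * A).PosDef) (hμ : 0 < μ) (J n : ℕ) (x₀ : Fin d → ℝ) {k : ℕ}
    {a : ℝ} {s : Regs m d} (h : Tracks A b μ J n x₀ k a s) (l : ℕ) :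
    Spec A b (stepsProg μ J n a l) s (l * (5 + (J + 1) * (1 + (J + 1) * (20 * n + 16))))
      (Tracks A b μ J n x₀ (k + l)) := by
  induction l with
  | zero => exact (Spec.done h).mono (by simp) fun _ _ h => h
  | succ l ih =>
    rw [Nat.succ_mul]
    refine ih.bind fun a' s' h' => ?_
    obtain ⟨rfl, hb, hx, hv⟩ := h'
    refine (spec_accelProg (A := A) hμ _ J n hb hx hv fun h0 => ?_).mono le_rfl
      fun a'' s'' h'' => ⟨h''.1, h''.2.1, h''.2.2.1, fun _ => h''.2.2.2⟩
    generalize k + l = j at *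
    cases j with
    | zero => rfl
    | succ j => exact absurd h0 (track_mass_pos hA hμ J n x₀ j).ne'

/-- The method that makes `T` accelerated steps in each iteration. -/
def accelMethod (μ : ℝ) (J n T : ℕ) : Method where
  State := ℝ
  init := 0
  step a := stepsProg μ J n a T

lemma tracks_exec (hA : (Aᵀ * A).PosDef) (hμ : 0 < μ) (J n T : ℕ) (x₀ : Fin d → ℝ) (k : ℕ) :
    Tracks A b μ J n x₀ (k * T) ((accelMethod μ J n T).exec A b x₀ k).1
      ((accelMethod μ J n T).exec A b x₀ k).2 := by
  induction k with
  | zero =>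
    rw [zero_mul]
    exact ⟨rfl, rfl, rfl, fun h => absurd rfl h⟩
  | succ k ih =>
    rw [Nat.succ_mul]
    exact (spec_stepsProg hA hμ J n x₀ ih T).1

lemma iterate_accelMethod (hA : (Aᵀ * A).PosDef) (hμ : 0 < μ) (J n T : ℕ) (x₀ : Fin d → ℝ)
    (k : ℕ) :
    (accelMethod μ J n T).iterate A b x₀ k = (track A b μ J n x₀ (k * T)).2.1 :=
  (tracks_exec hA hμ J n T x₀ k).2.2.1

lemma iterCost_accelMethod (hA : (Aᵀ * A).PosDef) (hμ : 0 < μ) (J n T : ℕ) (x₀ : Fin d → ℝ)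
    (k : ℕ) :
    (accelMethod μ J n T).iterCost A b x₀ k ≤
      T * (5 + (J + 1) * (1 + (J + 1) * (20 * n + 16))) :=
  (spec_stepsProg hA hμ J n x₀ (tracks_exec hA hμ J n T x₀ k) T).2

end Programs

/-! ### The rate of convergence -/

section Rate

/-- If a mass `a` grows by `θ √(l a)`, then either `a / l` is at least `s²` or the logarithm of the
mass grows by at least `θ / (2 s)`. -/
lemma one_le_add_log_sub_log {θ s l a a' : ℝ} (hθ : 0 < θ) (hθ1 : θ ≤ 1) (hs : 1 ≤ s) (hl : 0 < l)
    (ha : 0 < a) (h : a + θ * √(l * a) ≤ a') :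
    1 ≤ a / l / s ^ 2 + 2 * s / θ * (Real.log a' - Real.log a) := by
  have hs0 : 0 < s := by linarith
  have haa : a ≤ a' := le_trans (le_add_of_nonneg_right (by positivity)) h
  have ha' : 0 < a' := ha.trans_le haa
  have hlog : 0 ≤ Real.log a' - Real.log a := sub_nonneg.2 (Real.log_le_log ha haa)
  by_cases hc : s ^ 2 ≤ a / l
  · have h1 : 1 ≤ a / l / s ^ 2 := (one_le_div (by positivity)).2 hc
    have h2 : 0 ≤ 2 * s / θ * (Real.log a' - Real.log a) := by positivity
    linarith
  · rw [not_le, div_lt_iff₀ hl] at hc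
    have h1 : a / s ≤ √(l * a) := by
      refine Real.le_sqrt_of_sq_le ?_
      rw [div_pow, div_le_iff₀ (by positivity)]
      nlinarith
    have h2 : a * (1 + θ / s) ≤ a' := by
      have := mul_le_mul_of_nonneg_left h1 hθ.le
      calc a * (1 + θ / s) = a + θ * (a / s) := by ring
        _ ≤ a' := by linarith
    have hu : 0 < θ / s := by positivity
    have hu1 : θ / s ≤ 1 := div_le_one_of_le₀ (hθ1.trans hs) hs0.le
    have h3 := Real.log_le_log (by positivity) h2
    rw [Real.log_mul ha.ne' (by positivity)] at h3
    have h4 := Real.one_sub_inv_le_log_of_pos (by positivity : 0 < 1 + θ / s)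
    have h5 : θ / s / 2 ≤ 1 - (1 + θ / s)⁻¹ := by
      rw [← one_div, le_sub_iff_add_le, ← le_sub_iff_add_le', div_le_iff₀ (by positivity)]
      nlinarith
    have h6 : θ / s / 2 ≤ Real.log a' - Real.log a := by linarith
    have h7 := mul_le_mul_of_nonneg_left h6 (by positivity : 0 ≤ 2 * s / θ)
    have h8 : 2 * s / θ * (θ / s / 2) = 1 := by field_simp
    have h9 : 0 ≤ a / l / s ^ 2 := by positivity
    linarith

variable {m d : ℕ} {A : Matrix (Fin m) (Fin d) ℝ} {b : Fin m → ℝ} {μ : ℝ}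

lemma objective_le_smoothObjective [NeZero m] (hμ : 0 < μ) (x : Fin d → ℝ) :
    objective A b x ≤ smoothObjective A b μ x := by
  set y := A *ᵥ x - b with hy
  have hterm : ∀ k, pm y k ≤ smoothObjective A b μ x := fun k => by
    have h1 : Real.exp (pm y k / μ) ≤ ∑ j, Real.exp (pm y j / μ) :=
      Finset.single_le_sum (f := fun j => Real.exp (pm y j / μ))
        (fun _ _ => (Real.exp_pos _).le) (Finset.mem_univ k)
    have h2 := Real.log_le_log (Real.exp_pos _) h1
    rw [Real.log_exp] at h2
    have h3 := mul_le_mul_of_nonneg_left h2 hμ.le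
    rwa [mul_div_cancel₀ _ hμ.ne'] at h3
  have habs : ∀ i, ‖y i‖ ≤ smoothObjective A b μ x := fun i =>
    abs_le'.2 ⟨hterm (Sum.inl i), hterm (Sum.inr i)⟩
  exact (pi_norm_le_iff_of_nonneg ((norm_nonneg _).trans (habs 0))).2 habs

lemma smoothObjective_le [NeZero m] (hμ : 0 < μ) (x : Fin d → ℝ) :
    smoothObjective A b μ x ≤ objective A b x + μ * Real.log (2 * m) := by
  set y := A *ᵥ x - b with hy
  have hm : (0 : ℝ) < m := Nat.cast_pos.2 (NeZero.pos m)
  have h1 : ∑ k, Real.exp (pm y k / μ) ≤ 2 * m * Real.exp (‖y‖ / μ) := by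
    calc _ ≤ ∑ _k : Fin m ⊕ Fin m, Real.exp (‖y‖ / μ) := by
          refine Finset.sum_le_sum fun k _ => Real.exp_le_exp.2 ?_
          gcongr
          exact (le_abs_self _).trans (abs_pm_le y k)
      _ = 2 * m * Real.exp (‖y‖ / μ) := by simp; ring
  have h2 := Real.log_le_log (sum_exp_pos μ (pm y)) h1
  rw [Real.log_mul (by positivity) (Real.exp_pos _).ne', Real.log_exp] at h2
  have h3 := mul_le_mul_of_nonneg_left h2 hμ.le
  rw [mul_add, mul_div_cancel₀ _ hμ.ne'] at h3
  calc smoothObjective A b μ x ≤ μ * Real.log (2 * m) + ‖y‖ := h3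
    _ = _ := by rw [add_comm]; rfl

lemma objective_sub_le (x z : Fin d → ℝ) :
    objective A b x - objective A b z ≤ ‖emb A (x - z)‖ := by
  refine (norm_sub_norm_le _ _).trans ?_
  rw [sub_sub_sub_cancel_right, ← Matrix.mulVec_sub]
  exact norm_mulVec_le A _

lemma pairWeight_le_one (J : ℕ) : pairWeight J ≤ 1 := by
  rw [pairWeight, div_le_one (by positivity)]
  exact one_le_pow₀ (by linarith [Nat.cast_nonneg (α := ℝ) J])

/-- The rate of convergence, up to factors that are polynomial in `J`: the number of accelerated steps
needed is of the order of `s`, where `s³` is of the order of `(R / μ)²`. -/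
lemma smoothObjective_track_sub_le [NeZero m] (hA : (Aᵀ * A).PosDef) (hμ : 0 < μ) {J n T : ℕ}
    {x₀ xs : Fin d → ℝ} {R ε s : ℝ} (hε : 0 < ε) (hR : ‖emb A (x₀ - xs)‖ ≤ R)
    (hn : 32 * √(1 + grid μ J / μ) ≤ 2 ^ n) (hJ : R ^ 2 / ε ≤ pairWeight J * grid μ J)
    (hs : 1 ≤ s) (hs3 : 4096 * R ^ 2 / (pairWeight J * μ ^ 2) ≤ s ^ 3)
    (hT : 1 + s + 2 * s / pairWeight J * J < T) :
    smoothObjective A b μ (track A b μ J n x₀ T).2.1 - smoothObjective A b μ xs ≤ ε / 2 := by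
  by_contra! hgap
  set θ := pairWeight J with hθ
  have hθ0 : 0 < θ := pairWeight_pos J
  set M : ℕ → ℝ := fun k => (track A b μ J n x₀ k).1 with hM
  set Ψ : ℕ → ℝ := fun k =>
    M k * (smoothObjective A b μ (track A b μ J n x₀ k).2.1 - smoothObjective A b μ xs)
      + ‖emb A ((track A b μ J n x₀ k).2.2 - xs)‖ ^ 2 / 2 with hΨ
  have hM0 : ∀ k, 0 ≤ M k := track_mass_nonneg hA hμ J n x₀
  have hMge : ∀ k, M k + θ * grid μ 0 ≤ M (k + 1) := fun k => nextMass_ge hA hμ (hM0 k) _ _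
  have hg0 : 0 < θ * grid μ 0 := mul_pos hθ0 (grid_pos hμ 0)
  have hmono : Monotone M := monotone_nat_of_le_succ fun k => by linarith [hMge k]
  choose D hD0 hDΨ hDalt using fun k => accel_progress (b := b) hA hμ (hM0 k)
    (track A b μ J n x₀ k).2.1 (track A b μ J n x₀ k).2.2 xs hn
  have hstep : ∀ k, Ψ (k + 1) ≤ Ψ k - D k := hDΨ
  have hΨanti : Antitone Ψ := antitone_nat_of_succ_le fun k => by linarith [hstep k, hD0 k]
  have hR0 : 0 ≤ R := (norm_nonneg _).trans hR
  have hΨ0 : Ψ 0 ≤ R ^ 2 / 2 := by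
    have : Ψ 0 = ‖emb A (x₀ - xs)‖ ^ 2 / 2 := by simp [hΨ, hM, track]
    rw [this]
    have := pow_le_pow_left₀ (norm_nonneg _) hR 2
    linarith
  have hT1 : 1 ≤ T := by
    have : (0 : ℝ) < T := by
      have : 0 ≤ 2 * s / θ * J := by positivity
      linarith
    exact_mod_cast this
  have hΨT : 0 ≤ Ψ T := add_nonneg (mul_nonneg (hM0 T) (by linarith)) (by positivity)
  have hMT : M T < R ^ 2 / ε := by
    have h1 : M T * (ε / 2) < M T * (smoothObjective A b μ (track A b μ J n x₀ T).2.1 -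
        smoothObjective A b μ xs) := by
      refine mul_lt_mul_of_pos_left hgap ?_
      obtain ⟨T', rfl⟩ := Nat.exists_eq_add_of_le' hT1
      exact track_mass_pos hA hμ J n x₀ T'
    have h2 : Ψ T ≤ R ^ 2 / 2 := (hΨanti (Nat.zero_le T)).trans hΨ0
    have h3 : 0 ≤ ‖emb A ((track A b μ J n x₀ T).2.2 - xs)‖ ^ 2 / 2 := by positivity
    rw [lt_div_iff₀ hε]
    simp only [hΨ] at h2
    linarith
  -- The two alternatives of `one_le_add_log_sub_log` are paid for by the potential and by the
  -- growth of the mass, respectively.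
  set ρ := θ * (μ / 32) ^ 2 / 8 with hρ
  have hρ0 : 0 < ρ := by positivity
  have hcount : ∀ k, k + 1 ≤ T → (k : ℝ) ≤
      (Ψ 1 - Ψ (k + 1)) / (ρ * s ^ 2) + 2 * s / θ * (Real.log (M (k + 1)) - Real.log (M 1)) := by
    intro k
    induction k with
    | zero => simp
    | succ k ih =>
      intro hk
      have h1 := ih (by omega)
      rcases hDalt (k + 1) with hbig | ⟨l, hl, hgrow, hdrop⟩
      · exfalso
        have h2 : M (k + 1 + 1) ≤ M T := hmono hk
        have h3 : θ * grid μ J ≤ M (k + 1 + 1) := hbig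
        linarith
      · have hMk : 0 < M (k + 1) := by linarith [hMge k, hM0 k]
        have h2 := one_le_add_log_sub_log hθ0 (pairWeight_le_one J) hs hl hMk hgrow
        have h3 : M (k + 1) / l / s ^ 2 ≤ (Ψ (k + 1) - Ψ (k + 1 + 1)) / (ρ * s ^ 2) := by
          rw [← div_div _ ρ]
          refine div_le_div_of_nonneg_right ?_ (by positivity)
          rw [le_div_iff₀ hρ0]
          have h4 := hstep (k + 1)
          have h5 : θ * (M (k + 1) / l * (μ / 32) ^ 2) / 8 ≤ D (k + 1) := hdrop
          calc M (k + 1) / l * ρ = θ * (M (k + 1) / l * (μ / 32) ^ 2) / 8 := by rw [hρ]; ring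
            _ ≤ _ := by linarith
        have h6 : Real.log (nextMass A b μ J n (M (k + 1)) (track A b μ J n x₀ (k + 1)).2.1
            (track A b μ J n x₀ (k + 1)).2.2) = Real.log (M (k + 1 + 1)) := rfl
        rw [h6] at h2
        push_cast
        have e1 : (Ψ 1 - Ψ (k + 1 + 1)) / (ρ * s ^ 2) = (Ψ 1 - Ψ (k + 1)) / (ρ * s ^ 2) +
            (Ψ (k + 1) - Ψ (k + 1 + 1)) / (ρ * s ^ 2) := by rw [← add_div]; ring_nf
        rw [e1]
        linarith
  obtain ⟨T', rfl⟩ := Nat.exists_eq_add_of_le' hT1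
  have h1 := hcount T' le_rfl
  have h2 : (Ψ 1 - Ψ (T' + 1)) / (ρ * s ^ 2) ≤ s := by
    have h3 : Ψ 1 - Ψ (T' + 1) ≤ R ^ 2 / 2 := by linarith [hΨanti (Nat.zero_le 1)]
    rw [div_le_iff₀ (by positivity)]
    have h4 : 4096 * R ^ 2 / (θ * μ ^ 2) = R ^ 2 / 2 / ρ := by
      rw [hρ]; field_simp; ring
    rw [h4, div_le_iff₀ hρ0] at hs3
    calc _ ≤ R ^ 2 / 2 := h3
      _ ≤ s ^ 3 * ρ := hs3
      _ = _ := by ring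
  have h5 : Real.log (M (T' + 1)) - Real.log (M 1) ≤ J := by
    have hM1 : θ * grid μ 0 ≤ M 1 := by linarith [hMge 0, hM0 0]
    have h6 : Real.log (M (T' + 1)) ≤ Real.log (θ * grid μ J) :=
      Real.log_le_log (hg0.trans_le (hM1.trans (hmono (by omega)))) (hMT.le.trans hJ)
    have h7 := Real.log_le_log hg0 hM1
    have h8 : θ * grid μ J = 2 ^ J * (θ * grid μ 0) := by simp only [grid, pow_zero]; ring
    rw [h8, Real.log_mul (by positivity) hg0.ne', Real.log_pow] at h6
    have h9 : (J : ℝ) * Real.log 2 ≤ J * 1 := by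
      gcongr
      linarith [Real.log_two_lt_d9]
    linarith
  have h10 := mul_le_mul_of_nonneg_left h5 (by positivity : 0 ≤ 2 * s / θ)
  push_cast at hT
  linarith

end Rate

/-! ### The parameters -/

section Parameters

/-- An upper bound for `R / ε`, of the same order, recovered from the number of iterations. -/
def ratioBound (m N : ℕ) : ℝ := ((N + 1) / (2 * Real.log m ^ (3 / 5 : ℝ))) ^ (5 / 4 : ℝ)

/-- A natural number of the order of `log (2 + m R / ε)`. The summand `25` is where `2 ^ k` starts to
dominate the cubic polynomial of `cube_le_two_pow`. -/
def logScale (m N : ℕ) : ℕ := ⌈5 * Real.log (2 + m * ratioBound m N)⌉₊ + 25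

lemma half_le_log {m : ℕ} (hm : 2 ≤ m) : 1 / 2 ≤ Real.log m := by
  have h1 : Real.log 2 ≤ Real.log m := Real.log_le_log two_pos (by exact_mod_cast hm)
  linarith [Real.log_two_gt_d9]

lemma half_le_log_rpow {m : ℕ} (hm : 2 ≤ m) : 1 / 2 ≤ Real.log m ^ (3 / 5 : ℝ) := by
  calc (1 / 2 : ℝ) = (1 / 2 : ℝ) ^ (1 : ℝ) := (Real.rpow_one _).symm
    _ ≤ (1 / 2 : ℝ) ^ (3 / 5 : ℝ) :=
        Real.rpow_le_rpow_of_exponent_ge (by norm_num) (by norm_num) (by norm_num)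
    _ ≤ _ := Real.rpow_le_rpow (by norm_num) (half_le_log hm) (by norm_num)

lemma rpow_four_fifths_rpow {q : ℝ} (hq : 0 ≤ q) : (q ^ (4 / 5 : ℝ)) ^ (5 / 4 : ℝ) = q := by
  rw [← Real.rpow_mul hq]; norm_num

variable {m N : ℕ} {q : ℝ}

lemma le_ratioBound (hm : 2 ≤ m) (hq : 0 ≤ q)
    (h : 2 * (Real.log m ^ (3 / 5 : ℝ) * q ^ (4 / 5 : ℝ)) < N + 1) : q ≤ ratioBound m N := by
  have hg : 0 < Real.log m ^ (3 / 5 : ℝ) := by linarith [half_le_log_rpow hm]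
  rw [← rpow_four_fifths_rpow hq, ratioBound]
  refine Real.rpow_le_rpow (by positivity) ?_ (by norm_num)
  rw [le_div_iff₀ (by positivity)]
  linarith

lemma ratioBound_le (hm : 2 ≤ m) (hq : 0 ≤ q) (hN : 1 ≤ N)
    (h : N ≤ 2 * (Real.log m ^ (3 / 5 : ℝ) * q ^ (4 / 5 : ℝ))) : ratioBound m N ≤ 4 * q := by
  have hg : 0 < Real.log m ^ (3 / 5 : ℝ) := by linarith [half_le_log_rpow hm]
  have hN' : (1 : ℝ) ≤ N := by exact_mod_cast hN
  have h1 : ((N : ℝ) + 1) / (2 * Real.log m ^ (3 / 5 : ℝ)) ≤ 2 * q ^ (4 / 5 : ℝ) := by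
    rw [div_le_iff₀ (by positivity)]; linarith
  calc ratioBound m N ≤ (2 * q ^ (4 / 5 : ℝ)) ^ (5 / 4 : ℝ) :=
        Real.rpow_le_rpow (by positivity) h1 (by norm_num)
    _ = 2 ^ (5 / 4 : ℝ) * q := by
        rw [Real.mul_rpow (by norm_num) (by positivity), rpow_four_fifths_rpow hq]
    _ ≤ 2 ^ (2 : ℝ) * q := by
        gcongr
        · norm_num
        · norm_num
    _ = 4 * q := by norm_num

lemma ratioBound_sq_le (hm : 2 ≤ m) (hN : 1 ≤ N) : ratioBound m N ^ 2 ≤ 8 * (N : ℝ) ^ 3 := by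
  have hg := half_le_log_rpow hm
  have hN' : (1 : ℝ) ≤ N := by exact_mod_cast hN
  have h1 : ((N : ℝ) + 1) / (2 * Real.log m ^ (3 / 5 : ℝ)) ≤ 2 * N := by
    rw [div_le_iff₀ (by positivity)]; nlinarith
  have h2 : ratioBound m N ≤ (2 * N : ℝ) ^ (5 / 4 : ℝ) :=
    Real.rpow_le_rpow (by positivity) h1 (by norm_num)
  have h0 : 0 ≤ ratioBound m N := by unfold ratioBound; positivity
  calc ratioBound m N ^ 2 ≤ ((2 * N : ℝ) ^ (5 / 4 : ℝ)) ^ 2 := pow_le_pow_left₀ h0 h2 2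
    _ = (2 * N : ℝ) ^ (5 / 2 : ℝ) := by
        rw [← Real.rpow_natCast, ← Real.rpow_mul (by positivity)]; norm_num
    _ ≤ (2 * N : ℝ) ^ (3 : ℝ) :=
        Real.rpow_le_rpow_of_exponent_le (by linarith) (by norm_num)
    _ = 8 * (N : ℝ) ^ 3 := by
        rw [show (3 : ℝ) = ((3 : ℕ) : ℝ) by norm_num, Real.rpow_natCast]; ring

lemma ratioBound_pos (hm : 2 ≤ m) : 0 < ratioBound m N := by
  have := half_le_log_rpow hm
  unfold ratioBound; positivity

/-- Since at least one iteration is made, `R / ε` is not much smaller than `(log m)^{-3/4}`, so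
that `log m` is of the order of `log (2 + m R / ε)` at most. -/
lemma log_le_four_mul_log (hm : 2 ≤ m) (hN : 1 ≤ N) :
    Real.log m ≤ 4 * Real.log (2 + m * ratioBound m N) := by
  have hl : 0 < Real.log m := by linarith [half_le_log hm]
  have hg : 0 < Real.log m ^ (3 / 5 : ℝ) := by positivity
  have hQ := ratioBound_pos (N := N) hm
  have hm0 : (0 : ℝ) < m := by exact_mod_cast (by omega : 0 < m)
  have hN' : (1 : ℝ) ≤ N := by exact_mod_cast hN
  have h1 : -(3 / 5) * Real.log (Real.log m) ≤
      Real.log ((N + 1) / (2 * Real.log m ^ (3 / 5 : ℝ))) := by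
    have h2 : (Real.log m ^ (3 / 5 : ℝ))⁻¹ ≤ (N + 1) / (2 * Real.log m ^ (3 / 5 : ℝ)) := by
      rw [← one_div, div_le_div_iff₀ hg (by positivity)]
      nlinarith
    have h3 := Real.log_le_log (by positivity) h2
    rw [Real.log_inv, Real.log_rpow hl] at h3
    linarith
  have h4 : Real.log (ratioBound m N) =
      5 / 4 * Real.log ((N + 1) / (2 * Real.log m ^ (3 / 5 : ℝ))) := by
    rw [ratioBound, Real.log_rpow (by positivity)]
  have h5 := Real.log_le_sub_one_of_pos hl
  have h6 : Real.log m + Real.log (ratioBound m N) ≤ Real.log (2 + m * ratioBound m N) := by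
    rw [← Real.log_mul hm0.ne' hQ.ne']
    exact Real.log_le_log (by positivity) (by linarith)
  linarith

lemma log_two_mul_le (hm : 2 ≤ m) (hN : 1 ≤ N) : Real.log (2 * m) ≤ logScale m N := by
  have hQ := ratioBound_pos (N := N) hm
  have hm0 : (0 : ℝ) < m := by exact_mod_cast (by omega : 0 < m)
  have h1 := log_le_four_mul_log hm hN
  have h2 : Real.log 2 ≤ Real.log (2 + m * ratioBound m N) :=
    Real.log_le_log two_pos (by nlinarith [mul_pos hm0 hQ])
  have h3 := Nat.le_ceil (5 * Real.log (2 + m * ratioBound m N))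
  rw [Real.log_mul two_ne_zero hm0.ne', logScale]
  push_cast
  linarith

lemma ratioBound_sq_le_two_pow (hm : 2 ≤ m) : ratioBound m N ^ 2 ≤ 2 ^ logScale m N := by
  have hQ := ratioBound_pos (N := N) hm
  have hm0 : (1 : ℝ) ≤ m := by exact_mod_cast (by omega : 1 ≤ m)
  have h1 : ratioBound m N ≤ 2 + m * ratioBound m N := by nlinarith
  have h2 := Real.log_le_log hQ h1
  have h3 := Nat.le_ceil (5 * Real.log (2 + m * ratioBound m N))
  have h4 : 0 ≤ Real.log (2 + m * ratioBound m N) := Real.log_nonneg (by nlinarith)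
  rw [← Real.log_le_log_iff (by positivity) (by positivity), Real.log_pow, Real.log_pow, logScale]
  push_cast
  have h5 := Real.log_two_gt_d9
  have h6 : (5 * Real.log (2 + m * ratioBound m N)) * (1 / 2) ≤
      (⌈5 * Real.log (2 + m * ratioBound m N)⌉₊ + 25) * Real.log 2 :=
    mul_le_mul (by linarith) (by linarith) (by norm_num) (by positivity)
  linarith

lemma cube_le_two_pow {k : ℕ} (hk : 25 ≤ k) : 32 * (2 * k + 1) ^ 3 ≤ 2 ^ k := by
  induction k, hk using Nat.le_induction with
  | base => norm_num
  | succ k hk ih =>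
    rw [pow_succ 2 k]
    have : (2 * (k + 1) + 1) ^ 3 ≤ 2 * (2 * k + 1) ^ 3 := by
      obtain ⟨j, rfl⟩ := Nat.exists_eq_add_of_le hk
      ring_nf
      nlinarith [sq_nonneg j, Nat.zero_le (j ^ 3)]
    omega

lemma logScale_le (hm : 2 ≤ m) (hq : 0 ≤ q) (h : ratioBound m N ≤ 4 * q) :
    2 * (logScale m N : ℝ) + 1 ≤ 110 * Real.log (2 + m * q) := by
  have hQ := ratioBound_pos (N := N) hm
  have hm0 : (0 : ℝ) < m := by exact_mod_cast (by omega : 0 < m)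
  have h1 : Real.log (2 + m * ratioBound m N) ≤ Real.log (4 * (2 + m * q)) :=
    Real.log_le_log (by positivity) (by nlinarith)
  have h2 : Real.log 4 = 2 * Real.log 2 := by
    rw [show (4 : ℝ) = 2 ^ 2 by norm_num, Real.log_pow]; norm_num
  rw [Real.log_mul (by norm_num) (by positivity), h2] at h1
  have h3 : Real.log 2 ≤ Real.log (2 + m * q) := Real.log_le_log two_pos (by nlinarith)
  have h4 := Real.log_two_gt_d9
  have h5 : 0 ≤ 5 * Real.log (2 + m * ratioBound m N) := by
    have := Real.log_nonneg (by nlinarith [mul_pos hm0 hQ] : 1 ≤ 2 + m * ratioBound m N)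
    linarith
  have h6 := (Nat.ceil_lt_add_one h5).le
  rw [logScale]
  push_cast
  linarith

end Parameters

/-- The method: `256 (J + 1)⁵` accelerated steps in each iteration, for the smoothing parameter
`ε / (2 log (2 m))`, on a grid of `J + 1` step sizes with `J` of the order of `log (2 + m R / ε)`. -/
def regressionMethod (m _d : ℕ) (ε : ℝ) (N : ℕ) : Method :=
  accelMethod (ε / (2 * Real.log (2 * m))) (2 * logScale m N) (2 * logScale m N + 5)
    (256 * (2 * logScale m N + 1) ^ 5)

variable {m d : ℕ} {A : Matrix (Fin m) (Fin d) ℝ} {b : Fin m → ℝ}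

lemma log_two_mul_pos (hm : 2 ≤ m) : 0 < Real.log (2 * m) := by
  have : (2 : ℝ) ≤ m := by exact_mod_cast hm
  exact Real.log_pos (by linarith)

lemma objective_regressionMethod_sub_le (hm : 2 ≤ m) (hA : (Aᵀ * A).PosDef) {ε R : ℝ}
    (hε : 0 < ε) {x₀ xs : Fin d → ℝ} (hR : ‖emb A (x₀ - xs)‖ ≤ R) {N : ℕ} (hN : 1 ≤ N)
    (hQ : R / ε ≤ ratioBound m N) :
    objective A b ((regressionMethod m d ε N).iterate A b x₀ N) - objective A b xs ≤ ε := by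
  have : NeZero m := ⟨by omega⟩
  set l := Real.log (2 * m) with hl
  have hl0 : 0 < l := log_two_mul_pos hm
  set μ := ε / (2 * l) with hμdef
  have hμ : 0 < μ := by positivity
  set k := logScale m N with hk
  set J := 2 * k with hJdef
  set Q := ratioBound m N with hQdef
  have hR0 : 0 ≤ R := (norm_nonneg _).trans hR
  have hRQ : R ≤ Q * ε := (div_le_iff₀ hε).1 hQ
  have hQ0 : 0 < Q := ratioBound_pos hm
  have hR2 : R ^ 2 ≤ Q ^ 2 * ε ^ 2 := by rw [← mul_pow]; exact pow_le_pow_left₀ hR0 hRQ 2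
  have hlk : l ≤ (J : ℝ) + 1 := by
    have := log_two_mul_le hm hN
    have h2 : (J : ℝ) = 2 * k := by rw [hJdef]; push_cast; rfl
    rw [h2]; linarith [Nat.cast_nonneg (α := ℝ) k]
  have hj1 : (1 : ℝ) ≤ (J : ℝ) + 1 := by linarith [Nat.cast_nonneg (α := ℝ) J]
  have hN' : (1 : ℝ) ≤ N := by exact_mod_cast hN
  have hpow : 32 * l * Q ^ 2 * ((J : ℝ) + 1) ^ 2 ≤ 2 ^ J := by
    have h1 : (32 : ℝ) * ((J : ℝ) + 1) ^ 3 ≤ 2 ^ k := by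
      have := cube_le_two_pow (k := k) (by rw [hk, logScale]; omega)
      rw [hJdef]
      exact_mod_cast this
    calc 32 * l * Q ^ 2 * ((J : ℝ) + 1) ^ 2
        ≤ 32 * ((J : ℝ) + 1) * Q ^ 2 * ((J : ℝ) + 1) ^ 2 := by gcongr
      _ = (32 * ((J : ℝ) + 1) ^ 3) * Q ^ 2 := by ring
      _ ≤ 2 ^ k * 2 ^ k := by
          refine mul_le_mul h1 (ratioBound_sq_le_two_pow hm) (by positivity) (by positivity)
      _ = 2 ^ J := by rw [hJdef, two_mul, pow_add]
  have hθ : pairWeight J = 1 / ((J : ℝ) + 1) ^ 2 := rfl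
  rw [regressionMethod, ← hl, ← hμdef, ← hk, ← hJdef, iterate_accelMethod hA hμ]
  -- `s³` has to dominate `16384 (R / ε)² l² (J + 1)²`, where `(R / ε)² ≤ 8 N³` and `l ≤ J + 1`.
  have hmain := smoothObjective_track_sub_le (b := b) hA hμ (J := J) (n := J + 5)
    (T := N * (256 * (J + 1) ^ 5)) (s := 64 * N * ((J : ℝ) + 1) ^ 2) hε hR ?_ ?_ ?_ ?_ ?_
  · have h1 := objective_le_smoothObjective (A := A) (b := b) hμ
      (track A b μ J (J + 5) x₀ (N * (256 * (J + 1) ^ 5))).2.1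
    have h2 := smoothObjective_le (A := A) (b := b) hμ xs
    have h3 : μ * l = ε / 2 := by rw [hμdef]; field_simp
    rw [← hl, h3] at h2
    linarith
  · have h2 : (2 : ℝ) ≤ 2 ^ J := by
      have hJ1 : 1 ≤ J := by rw [hJdef, hk, logScale]; omega
      calc (2 : ℝ) = 2 ^ 1 := (pow_one _).symm
        _ ≤ 2 ^ J := pow_le_pow_right₀ (by norm_num) hJ1
    have h3 : grid μ J / μ = 2 ^ J / 16 := by rw [grid]; field_simp
    have h4 : √(1 + grid μ J / μ) ≤ 2 ^ J := by
      rw [h3]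
      exact Real.sqrt_le_iff.2 ⟨by positivity, by nlinarith⟩
    rw [pow_add]
    linarith
  · have h1 : pairWeight J * grid μ J = ε * 2 ^ J / (32 * l * ((J : ℝ) + 1) ^ 2) := by
      rw [hθ, grid, hμdef]; field_simp; ring
    rw [h1, div_le_div_iff₀ hε (by positivity)]
    calc R ^ 2 * (32 * l * ((J : ℝ) + 1) ^ 2)
        ≤ Q ^ 2 * ε ^ 2 * (32 * l * ((J : ℝ) + 1) ^ 2) := by gcongr
      _ = (32 * l * Q ^ 2 * ((J : ℝ) + 1) ^ 2) * ε ^ 2 := by ring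
      _ ≤ 2 ^ J * ε ^ 2 := by gcongr
      _ = _ := by ring
  · have : (1 : ℝ) ≤ ((J : ℝ) + 1) ^ 2 := one_le_pow₀ hj1
    nlinarith
  · have h1 : 4096 * R ^ 2 / (pairWeight J * μ ^ 2) =
        16384 * R ^ 2 / ε ^ 2 * l ^ 2 * ((J : ℝ) + 1) ^ 2 := by
      rw [hθ, hμdef]; field_simp; ring
    have h2 : 16384 * R ^ 2 / ε ^ 2 ≤ 16384 * (8 * (N : ℝ) ^ 3) := by
      rw [div_le_iff₀ (by positivity)]
      have := mul_le_mul_of_nonneg_right (ratioBound_sq_le hm hN) (sq_nonneg ε)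
      linarith
    rw [h1]
    calc 16384 * R ^ 2 / ε ^ 2 * l ^ 2 * ((J : ℝ) + 1) ^ 2
        ≤ 16384 * (8 * (N : ℝ) ^ 3) * ((J : ℝ) + 1) ^ 2 * ((J : ℝ) + 1) ^ 2 := by gcongr
      _ = 131072 * (N : ℝ) ^ 3 * ((J : ℝ) + 1) ^ 4 := by ring
      _ ≤ 262144 * (N : ℝ) ^ 3 * ((J : ℝ) + 1) ^ 6 := by
          gcongr
          · norm_num
          · norm_num
      _ = _ := by ring
  · rw [hθ]
    push_cast
    set j := (J : ℝ) + 1 with hj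
    have e1 : 2 * (64 * (N : ℝ) * j ^ 2) / (1 / j ^ 2) * J = 128 * N * j ^ 4 * (j - 1) := by
      rw [hj]; field_simp; ring
    rw [e1]
    have h2 : (N : ℝ) * j ^ 2 ≤ N * j ^ 4 := by
      gcongr
      · norm_num
    have h3 : (N : ℝ) * j ^ 4 ≤ N * j ^ 5 := by
      gcongr
      · norm_num
    have h4 : 1 ≤ (N : ℝ) * j ^ 5 := by
      have := one_le_pow₀ (n := 5) hj1
      nlinarith
    nlinarith

lemma cost_le (k : ℕ) :
    256 * (2 * k + 1) ^ 5 *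
        (5 + (2 * k + 1) * (1 + (2 * k + 1) * (20 * (2 * k + 5) + 16))) ≤
      31232 * (2 * k + 1) ^ 8 := by
  have e : 20 * (2 * k + 5) + 16 = 20 * (2 * k + 1) + 96 := by ring
  have h3 : 5 + (2 * k + 1) * (1 + (2 * k + 1) * (20 * (2 * k + 1) + 96)) ≤
      122 * (2 * k + 1) ^ 3 := by
    ring_nf; nlinarith [Nat.zero_le (k ^ 2), Nat.zero_le (k ^ 3)]
  rw [e]
  calc _ ≤ 256 * (2 * k + 1) ^ 5 * (122 * (2 * k + 1) ^ 3) := Nat.mul_le_mul_left _ h3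
    _ = _ := by ring

lemma iterCost_regressionMethod_le (hm : 2 ≤ m) (hA : (Aᵀ * A).PosDef) {ε q : ℝ}
    (hε : 0 < ε) {x₀ : Fin d → ℝ} {N : ℕ} (hq : 0 ≤ q) (hQ : ratioBound m N ≤ 4 * q) (k : ℕ) :
    ((regressionMethod m d ε N).iterCost A b x₀ k : ℝ) ≤
      31232 * 110 ^ 8 * Real.log (2 + m * q) ^ 8 := by
  have : NeZero m := ⟨by omega⟩
  have hl0 : 0 < Real.log (2 * m) := log_two_mul_pos hm
  have hμ : 0 < ε / (2 * Real.log (2 * m)) := by positivity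
  have h1 := iterCost_accelMethod (b := b) hA hμ (2 * logScale m N) (2 * logScale m N + 5)
    (256 * (2 * logScale m N + 1) ^ 5) x₀ k
  have h2 := h1.trans (cost_le (logScale m N))
  have h3 : ((regressionMethod m d ε N).iterCost A b x₀ k : ℝ) ≤
      31232 * (2 * (logScale m N : ℝ) + 1) ^ 8 := by
    refine (Nat.cast_le.2 h2).trans (le_of_eq ?_)
    push_cast; rfl
  calc _ ≤ 31232 * (2 * (logScale m N : ℝ) + 1) ^ 8 := h3
    _ ≤ 31232 * (110 * Real.log (2 + m * q)) ^ 8 := by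
        gcongr
        exact logScale_le hm hq hQ
    _ = _ := by rw [mul_pow, mul_assoc]

end

end LinfReg

theorem theorem1 :
    ∃ (method : (m d : ℕ) → (ε : ℝ) → (N : ℕ) → LinfReg.Method) (C K : ℝ) (p : ℕ),
      0 < C ∧ 0 < K ∧
      ∀ (m d : ℕ) (A : Matrix (Fin m) (Fin d) ℝ) (b : Fin m → ℝ) (x₀ xstar : Fin d → ℝ) (ε R : ℝ)
        (N : ℕ),
        2 ≤ m → (Aᵀ * A).PosDef → 0 < ε →
        (∀ x, LinfReg.objective A b xstar ≤ LinfReg.objective A b x) →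
        LinfReg.matNorm (Aᵀ * A) (x₀ - xstar) ≤ R →
        N = ⌊C * (Real.log m ^ (3 / 5 : ℝ) * R ^ (4 / 5 : ℝ) / ε ^ (4 / 5 : ℝ))⌋₊ →
        LinfReg.objective A b ((method m d ε N).iterate A b x₀ N)
            - LinfReg.objective A b xstar ≤ ε ∧
        ∀ k < N, ((method m d ε N).iterCost A b x₀ k : ℝ) ≤ K * Real.log (2 + m * R / ε) ^ p := by
  refine ⟨LinfReg.regressionMethod, 2, 31232 * 110 ^ 8, 8, by norm_num, by positivity, ?_⟩
  intro m d A b x₀ xstar ε R N hm hA hε _ hR hN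
  rw [LinfReg.matNorm_eq] at hR
  have hR0 : 0 ≤ R := (norm_nonneg _).trans hR
  set q := R / ε with hqdef
  have hq : 0 ≤ q := by positivity
  have hg := LinfReg.half_le_log_rpow hm
  have hX : Real.log m ^ (3 / 5 : ℝ) * R ^ (4 / 5 : ℝ) / ε ^ (4 / 5 : ℝ) =
      Real.log m ^ (3 / 5 : ℝ) * q ^ (4 / 5 : ℝ) := by
    rw [hqdef, Real.div_rpow hR0 hε.le, mul_div_assoc]
  rw [hX] at hN
  have hX0 : 0 ≤ 2 * (Real.log m ^ (3 / 5 : ℝ) * q ^ (4 / 5 : ℝ)) := by positivity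
  have hlt : 2 * (Real.log m ^ (3 / 5 : ℝ) * q ^ (4 / 5 : ℝ)) < N + 1 := by
    rw [hN]; exact Nat.lt_floor_add_one _
  have hle : (N : ℝ) ≤ 2 * (Real.log m ^ (3 / 5 : ℝ) * q ^ (4 / 5 : ℝ)) := by
    rw [hN]; exact Nat.floor_le hX0
  rcases Nat.eq_zero_or_pos N with h0 | h0
  · -- No iteration is allowed, and none is needed, since `f` is 1-Lipschitz and `R ≤ ε`.
    refine ⟨?_, fun k hk => absurd hk (by omega)⟩
    subst h0
    have hq1 : q ≤ 1 := by
      by_contra! h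
      have h1 : 1 ≤ q ^ (4 / 5 : ℝ) := Real.one_le_rpow h.le (by norm_num)
      push_cast at hlt
      nlinarith
    have hRε : R ≤ ε := by
      rw [hqdef, div_le_one hε] at hq1; exact hq1
    exact (LinfReg.objective_sub_le x₀ xstar).trans (hR.trans hRε)
  · refine ⟨LinfReg.objective_regressionMethod_sub_le hm hA hε hR h0
      (LinfReg.le_ratioBound hm hq hlt), fun k _ => ?_⟩
    rw [mul_div_assoc]
    exact LinfReg.iterCost_regressionMethod_le hm hA hε hq (LinfReg.ratioBound_le hm hq h0 hle) k
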